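/- Let $n,m,r\in\mathbb N$, $T>0$, $B\in\mathbb R^{n,m}$, $C\in\mathbb R^{r,n}$, $x_0\in\mathbb R^n$ and $y\in L^2(0,T;\mathbb R^r)$ be fixed; matrices carry the spectral norm $\|\cdot\|$, and $\|x\|_P=\sqrt{x^\top P x}$. For $\mathcal S=(A,\Gamma,R,Q)$ with $A\in\mathbb R^{n,n}$ and symmetric positive definite $\Gamma\in\mathbb R^{n,n}$, $R\in\mathbb R^{m,m}$, $Q\in\mathbb R^{r,r}$ let $\Pi$ solve $\dot\Pi=A\Pi+\Pi A^\top-\Pi C^\top Q^{-1}C\Pi+BRB^\top$ on $(0,T)$, $\Pi(0)=\Gamma$, let $P=\Pi^{-1}$, let the Kalman filter $\widehat x\in H^1(0,T;\mathbb R^n)$ solve $\dot{\widehat x}=A\widehat x+\Pi C^\top Q^{-1}(y-C\widehat x)$ on $(0,T)$, $\widehat x(0)=x_0$, and let $$\mathcal V(t,\xi)=\inf\Big\{\tfrac12\|x(0)-x_0\|_{\Gamma^{-1}}^2+\tfrac12\int_0^t\|v(s)\|_{R^{-1}}^2+\|y(s)-Cx(s)\|_{Q^{-1}}^2\,\mathrm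 ds\Big\}$$ for $t\in(0,T]$, where the infimum is over $x\in H^1(0,t;\mathbb R^n)$, $v\in L^2(0,t;\mathbb R^m)$ with $\dot x=Ax+Bv$ on $(0,t)$ and $x(t)=\xi$, and $\mathcal V(0,\xi)=\tfrac12\|\xi-x_0\|_{\Gamma^{-1}}^2$. Put $\|\mathcal S\|_1=\|A\|+\|\Gamma\|+\|R\|+\|Q\|$, with differences of four-tuples taken componentwise. An uncertain system consists of finite nonempty sets $\Sigma_A\subset\mathbb R^{s_A}$, $\Sigma_\Gamma\subset\mathbb R^{s_\Gamma}$, $\Sigma_R\subset\mathbb R^{s_R}$, $\Sigma_Q\subset\mathbb R^{s_Q}$ and of matrix-valued functions $a,\gamma,\mathfrak r,q$ on these spaces, where $\gamma,\mathfrak r,q$ take symmetric positive definite values on $\Sigma_\Gamma,\Sigma_R,\Sigma_Q$. The set $\Sigma=\Sigma_A\times\Sigma_\Gamma\times\Sigma_R\times\Sigma_Q$, of cardinality $N$, carries the uniform distribution with expectation $\mathbb E$, and $\mathcal S_\sigma=(A_\sigma,\Gamma_\sigma,R_\sigma,Q_\sigma)=(a(\sigma_A),\gamma(\sigma_\Gamma),\mathfrak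 r(\sigma_R),q(\sigma_Q))$ for $\sigma\in\Sigma$. Write $\widehat x_\sigma,\Pi_\sigma,P_\sigma,\mathcal V_\sigma$ for the objects above that belong to $\mathcal S_\sigma$. The three estimators are: the Kalman filter $\widehat x_{\mathbb E}$ of $\mathcal S_{\mathbb E}=(\mathbb E A_\sigma,\mathbb E\Gamma_\sigma,\mathbb E R_\sigma,\mathbb E Q_\sigma)$; $\widehat x_\varnothing=\mathbb E[\widehat x_\sigma]$; and $\widehat x_{\mathrm E}(t)=\operatorname{argmin}_{\xi\in\mathbb R^n}\mathbb E[\mathcal V_\sigma(t,\xi)]$. Then for every $\rho$ there are constants $c_{\mathbb E},c_\varnothing,c_{\mathrm E}>0$, depending only on $T,B,C,x_0,y$ and $\rho$ (in particular not on $N$), such that the following holds for every uncertain system with $\|A_\sigma\|,\|\Gamma_\sigma\|,\|\Gamma_\sigma^{-1}\|,\|R_\sigma\|,\|Q_\sigma^{-1}\|\le\rho$ for all $\sigma\in\Sigma$. The Riccati and filter equations of all $\mathcal S_\sigma$ and of $\mathcal S_{\mathbb E}$ have unique solutions on $[0,T]$, the matrices $\Pi_\sigma(t)$ and $\Pi_{\mathbb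 E}(t)$ are positive definite, the minimizer $\widehat x_{\mathrm E}(t)$ exists and is unique for every $t\in[0,T]$, and for each of the three pairs $(\widehat x,c)\in\{(\widehat x_{\mathbb E},c_{\mathbb E}),(\widehat x_\varnothing,c_\varnothing),(\widehat x_{\mathrm E},c_{\mathrm E})\}$ and all $t\in[0,T]$ one has $$\|\widehat x(t)-\widehat x_{\bar\sigma}(t)\|_{P_{\bar\sigma}(t)}\le c\,\mathbb E_\sigma\big[\|\mathcal S_\sigma-\mathcal S_{\bar\sigma}\|_1\big]\quad\text{for all }\bar\sigma\in\Sigma,$$ and $$\mathbb E\big[\|\widehat x(t)-\widehat x_\sigma(t)\|_{P_\sigma(t)}\big]\le c\,\mathbb E_{\bar\sigma}\Big[\mathbb E_\sigma\big[\|\mathcal S_\sigma-\mathcal S_{\bar\sigma}\|_1\big]\Big].$$ -/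

import Mathlib

open MeasureTheory

-- Matrices carry the spectral norm (operator norm for the Euclidean norm).
open scoped Matrix Matrix.Norms.L2Operator

noncomputable section

namespace UncertainKalman

/-- The data that are known and fixed: horizon `T`, matrices `B`, `C`, undisturbed initial
state `x₀`, and the measured output `y ∈ L²(0,T;ℝ^r)`. -/
structure Setup (n m r : ℕ) where
  T : ℝ
  T_pos : 0 < T
  B : Matrix (Fin n) (Fin m) ℝ
  C : Matrix (Fin r) (Fin n) ℝ
  x₀ : Fin n → ℝ
  y : ℝ → Fin r → ℝ
  y_memLp : MemLp y 2 (volume.restrict (Set.Ioo 0 T))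

/-- A four-tuple `𝒮 = (A, Γ, R, Q)`. -/
structure Sys (n m r : ℕ) where
  A : Matrix (Fin n) (Fin n) ℝ
  Γ : Matrix (Fin n) (Fin n) ℝ
  R : Matrix (Fin m) (Fin m) ℝ
  Q : Matrix (Fin r) (Fin r) ℝ

variable {n m r : ℕ}

namespace Sys

instance : Sub (Sys n m r) :=
  ⟨fun S S' => ⟨S.A - S'.A, S.Γ - S'.Γ, S.R - S'.R, S.Q - S'.Q⟩⟩

/-- `‖𝒮‖₁ = ‖A‖ + ‖Γ‖ + ‖R‖ + ‖Q‖`. -/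
def norm1 (S : Sys n m r) : ℝ := ‖S.A‖ + ‖S.Γ‖ + ‖S.R‖ + ‖S.Q‖

end Sys

/-- `‖x‖_P² = xᵀ P x`. -/
def sqNorm {d : ℕ} (P : Matrix (Fin d) (Fin d) ℝ) (x : Fin d → ℝ) : ℝ := x ⬝ᵥ (P *ᵥ x)

/-- The weighted norm `‖x‖_P`. -/
def wNorm {d : ℕ} (P : Matrix (Fin d) (Fin d) ℝ) (x : Fin d → ℝ) : ℝ := √(sqNorm P x)

/-! ### The Kalman filter of a given system -/

/-- `Π` is a solution on `[0,T]` of the differential Riccati equation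
`Π' = A Π + Π Aᵀ - Π Cᵀ Q⁻¹ C Π + B R Bᵀ`, `Π(0) = Γ`. -/
structure IsRiccatiSol (F : Setup n m r) (S : Sys n m r)
    (P : ℝ → Matrix (Fin n) (Fin n) ℝ) : Prop where
  continuousOn : ContinuousOn P (Set.Icc 0 F.T)
  initial : P 0 = S.Γ
  deriv : ∀ t ∈ Set.Ioo 0 F.T,
    HasDerivAt P (S.A * P t + P t * S.Aᵀ - P t * F.Cᵀ * S.Q⁻¹ * F.C * P t
      + F.B * S.R * F.Bᵀ) t

/-- The error covariance `Π`, i.e. the solution of the Riccati equation. -/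
def errorCov (F : Setup n m r) (S : Sys n m r) : ℝ → Matrix (Fin n) (Fin n) ℝ :=
  Classical.epsilon (IsRiccatiSol F S)

/-- The precision matrix `P(t) = Π(t)⁻¹`. -/
def precision (F : Setup n m r) (S : Sys n m r) (t : ℝ) : Matrix (Fin n) (Fin n) ℝ :=
  (errorCov F S t)⁻¹

/-- `x` is a solution on `[0,T]` of `x' = A x + Π Cᵀ Q⁻¹ (y - C x)`, `x(0) = x₀`. As `y` is
only square integrable, this is the equation for `x ∈ H¹(0,T;ℝⁿ)`, in integrated form. -/
structure IsFilterSol (F : Setup n m r) (S : Sys n m r) (x : ℝ → Fin n → ℝ) : Prop where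
  continuousOn : ContinuousOn x (Set.Icc 0 F.T)
  integral_eq : ∀ t ∈ Set.Icc 0 F.T,
    x t = F.x₀ + ∫ s in (0 : ℝ)..t,
      (S.A *ᵥ x s + (errorCov F S s * F.Cᵀ * S.Q⁻¹) *ᵥ (F.y s - F.C *ᵥ x s))

/-- The Kalman filter trajectory `x̂`. -/
def kalman (F : Setup n m r) (S : Sys n m r) : ℝ → Fin n → ℝ :=
  Classical.epsilon (IsFilterSol F S)

/-! ### The energy value function of a given system -/

/-- Admissible pairs `(x, v) ∈ H¹(0,t;ℝⁿ) × L²(0,t;ℝ^m)`: `x' = A x + B v` on `(0,t)` (in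
integrated form) and `x(t) = ξ`. -/
structure IsAdmissible (F : Setup n m r) (S : Sys n m r) (t : ℝ) (ξ : Fin n → ℝ)
    (x : ℝ → Fin n → ℝ) (v : ℝ → Fin m → ℝ) : Prop where
  memLp : MemLp v 2 (volume.restrict (Set.Ioo 0 t))
  continuousOn : ContinuousOn x (Set.Icc 0 t)
  integral_eq : ∀ s ∈ Set.Icc 0 t,
    x s = x 0 + ∫ τ in (0 : ℝ)..s, (S.A *ᵥ x τ + F.B *ᵥ v τ)
  final : x t = ξ

/-- The energy `J(x,v;t)`. -/
def cost (F : Setup n m r) (S : Sys n m r) (t : ℝ)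
    (x : ℝ → Fin n → ℝ) (v : ℝ → Fin m → ℝ) : ℝ :=
  1 / 2 * sqNorm S.Γ⁻¹ (x 0 - F.x₀)
    + 1 / 2 * ∫ s in (0 : ℝ)..t, (sqNorm S.R⁻¹ (v s) + sqNorm S.Q⁻¹ (F.y s - F.C *ᵥ x s))

/-- The value function `𝒱(t,ξ)`: minimal energy needed to be in the state `ξ` at time `t`. -/
def valueFn (F : Setup n m r) (S : Sys n m r) (t : ℝ) (ξ : Fin n → ℝ) : ℝ :=
  if t = 0 then 1 / 2 * sqNorm S.Γ⁻¹ (ξ - F.x₀)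
  else sInf {J : ℝ | ∃ x v, IsAdmissible F S t ξ x v ∧ J = cost F S t x v}

/-! ### Uncertain systems -/

/-- Expectation with respect to the uniform distribution on a finite set. -/
def mean {ι V : Type*} [Fintype ι] [AddCommGroup V] [Module ℝ V] (f : ι → V) : V :=
  (Fintype.card ι : ℝ)⁻¹ • ∑ i, f i

/-- The four matrices are functions of uncertain parameters, which range over finite nonempty
sets `parA ⊂ ℝ^{s_A}` etc. The covariance matrices are symmetric positive definite. -/
structure Uncertainty (n m r : ℕ) where
  (sA sΓ sR sQ : ℕ)
  parA : Finset (Fin sA → ℝ)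
  parΓ : Finset (Fin sΓ → ℝ)
  parR : Finset (Fin sR → ℝ)
  parQ : Finset (Fin sQ → ℝ)
  parA_nonempty : parA.Nonempty
  parΓ_nonempty : parΓ.Nonempty
  parR_nonempty : parR.Nonempty
  parQ_nonempty : parQ.Nonempty
  a : (Fin sA → ℝ) → Matrix (Fin n) (Fin n) ℝ
  γ : (Fin sΓ → ℝ) → Matrix (Fin n) (Fin n) ℝ
  r' : (Fin sR → ℝ) → Matrix (Fin m) (Fin m) ℝ
  q : (Fin sQ → ℝ) → Matrix (Fin r) (Fin r) ℝ
  γ_posDef : ∀ σ ∈ parΓ, (γ σ).PosDef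
  r'_posDef : ∀ σ ∈ parR, (r' σ).PosDef
  q_posDef : ∀ σ ∈ parQ, (q σ).PosDef

namespace Uncertainty

/-- The product parameter set `Σ = Σ_A × Σ_Γ × Σ_R × Σ_Q`, with the uniform distribution. -/
abbrev Param (U : Uncertainty n m r) : Type :=
  U.parA × U.parΓ × U.parR × U.parQ

/-- `𝒮_σ = (A_σ, Γ_σ, R_σ, Q_σ)`. -/
def sys (U : Uncertainty n m r) (σ : U.Param) : Sys n m r where
  A := U.a σ.1
  Γ := U.γ σ.2.1
  R := U.r' σ.2.2.1
  Q := U.q σ.2.2.2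

/-- `𝒮_𝔼 = (𝔼 A_σ, 𝔼 Γ_σ, 𝔼 R_σ, 𝔼 Q_σ)`. -/
def meanSys (U : Uncertainty n m r) : Sys n m r where
  A := mean fun σ => (U.sys σ).A
  Γ := mean fun σ => (U.sys σ).Γ
  R := mean fun σ => (U.sys σ).R
  Q := mean fun σ => (U.sys σ).Q

/-- All `A_σ, Γ_σ, Γ_σ⁻¹, R_σ, Q_σ⁻¹` have norm at most `ρ`. -/
def BoundedBy (U : Uncertainty n m r) (ρ : ℝ) : Prop :=
  ∀ σ : U.Param, ‖(U.sys σ).A‖ ≤ ρ ∧ ‖(U.sys σ).Γ‖ ≤ ρ ∧ ‖(U.sys σ).Γ⁻¹‖ ≤ ρ ∧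
    ‖(U.sys σ).R‖ ≤ ρ ∧ ‖(U.sys σ).Q⁻¹‖ ≤ ρ

/-- The Kalman filter of the expected system. -/
def estExpSys (F : Setup n m r) (U : Uncertainty n m r) (t : ℝ) : Fin n → ℝ :=
  kalman F U.meanSys t

/-- The expected Kalman filter. -/
def estMean (F : Setup n m r) (U : Uncertainty n m r) (t : ℝ) : Fin n → ℝ :=
  mean fun σ => kalman F (U.sys σ) t

/-- The expected energy. -/
def energy (F : Setup n m r) (U : Uncertainty n m r) (t : ℝ) (ξ : Fin n → ℝ) : ℝ :=
  mean fun σ => valueFn F (U.sys σ) t ξ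

/-- `ξ` minimizes the expected energy at time `t`. -/
def IsEnergyMin (F : Setup n m r) (U : Uncertainty n m r) (t : ℝ) (ξ : Fin n → ℝ) : Prop :=
  ∀ ζ, U.energy F t ξ ≤ U.energy F t ζ

/-- The minimizer of the expected energy. -/
def estEnergy (F : Setup n m r) (U : Uncertainty n m r) (t : ℝ) : Fin n → ℝ :=
  Classical.epsilon (U.IsEnergyMin F t)

/-- The error `‖x̂(t) - x̂_σ(t)‖_{P_σ(t)}` of an estimator `x̂` when `σ` is the true parameter. -/
def error (F : Setup n m r) (U : Uncertainty n m r) (xhat : ℝ → Fin n → ℝ) (t : ℝ)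
    (σ : U.Param) : ℝ :=
  wNorm (precision F (U.sys σ) t) (xhat t - kalman F (U.sys σ) t)

/-- `𝔼_σ ‖𝒮_σ - 𝒮_σ'‖₁`, the mean deviation from the system with parameter `σ'`. -/
def deviation (U : Uncertainty n m r) (σ' : U.Param) : ℝ :=
  mean fun σ => (U.sys σ - U.sys σ').norm1

end Uncertainty

/-- The Riccati equation and the filter equation of `S` are uniquely solvable on `[0,T]`, and
the covariance is positive definite there: `errorCov`, `precision` and `kalman` are not junk. -/
structure WellPosed (F : Setup n m r) (S : Sys n m r) : Prop where
  riccati : IsRiccatiSol F S (errorCov F S)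
  riccati_unique : ∀ P, IsRiccatiSol F S P → Set.EqOn P (errorCov F S) (Set.Icc 0 F.T)
  posDef : ∀ t ∈ Set.Icc 0 F.T, (errorCov F S t).PosDef
  filter : IsFilterSol F S (kalman F S)
  filter_unique : ∀ x, IsFilterSol F S x → Set.EqOn x (kalman F S) (Set.Icc 0 F.T)

end UncertainKalman

end

noncomputable section

namespace UncertainKalman

open Set

variable {n m r : ℕ}

/-! The estimates rest on explicit formulas and compactness. With `W = Q⁻¹`, the Riccati equation is
linearized by the Hamiltonian system `X' = -Aᵀ X + Cᵀ W C Y`, `Y' = B R Bᵀ X + A Y`, `X(0) = 1`,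
`Y(0) = Γ`. The matrix `Xᵀ Y` is symmetric and nondecreasing and starts at `Γ > 0`, so `X` and `Y`
stay invertible for all `t ≥ 0`. Hence `Π = Y X⁻¹` and `P = X Y⁻¹` exist and are positive definite
(`flowCov_posDef`), and the filter is `X⁻ᵀ (x₀ + ∫ Yᵀ Cᵀ W y)` (`isPrimitiveOn_flowFilter`).

The flow is a matrix exponential, so the precision, `X⁻ᵀ` and the weight in front of `y` are `C¹` in
time and in `θ = (A, Γ, R, W)`. Coefficients bounded by `ρ`, with `Γ` bounded below, form the
compact set `coeffSet`; no lower bound on `R` or `W` is needed. Compactness gives a Lipschitz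
constant for the filter (`exists_lipschitz_flowFilter`) and upper and lower bounds for the precision
that depend only on the fixed data and `ρ`. The mean system has its coefficients in the same set,
because lower bounds on quadratic forms survive averaging. This settles the filter of the mean
system and, by the triangle inequality, the mean of the filters.

For the energy estimator, completing the square along trajectories (`running_cost_eq`, `cost_eq`)
and an optimal feedback (`exists_optimal`) show that the value function is `½ ‖ξ - x̂_σ‖²` in the
norm of `P_σ`, up to a constant in `ξ` (`valueFn_eq`). The expected energy is then a strictly convex
quadratic with optimality condition `𝔼 P_σ (ξ - x̂_σ) = 0`. Testing it with `ξ - x̂_σ'` bounds this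
difference by a multiple of `𝔼 ‖x̂_σ - x̂_σ'‖` (`norm_minimizer_sub_le`). -/

/-! ### Absolutely continuous functions -/

/-- `u` is on `[0,T]` the primitive of the integrable function `u'`. -/
structure IsPrimitiveOn (T : ℝ) (u u' : ℝ → ℝ) : Prop where
  integrable : IntervalIntegrable u' volume 0 T
  eq_integral : ∀ t ∈ Icc 0 T, u t = u 0 + ∫ s in (0 : ℝ)..t, u' s

namespace IsPrimitiveOn

variable {T : ℝ} {u u' w w' : ℝ → ℝ}

theorem continuousOn (hu : IsPrimitiveOn T u u') : ContinuousOn u (Icc 0 T) := by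
  rcases le_or_gt 0 T with hT | hT
  · have h := hu.integrable.absolutelyContinuousOnInterval_intervalIntegral
      (c := 0) (by simp)
    have h2 := h.continuousOn
    rw [uIcc_of_le hT] at h2
    exact (continuousOn_const.add h2).congr hu.eq_integral
  · rw [Icc_eq_empty (by linarith)]; exact continuousOn_empty _

theorem congr (hu : IsPrimitiveOn T u u') (hT : 0 ≤ T) (hw : EqOn w u (Icc 0 T))
    (hw' : ∀ s ∈ Icc 0 T, w' s = u' s) : IsPrimitiveOn T w w' := by
  have h0 : (0 : ℝ) ∈ Icc 0 T := ⟨le_rfl, hT⟩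
  refine ⟨hu.integrable.congr fun s hs => ?_, fun t ht => ?_⟩
  · rw [uIoc_of_le hT] at hs
    exact (hw' s ⟨hs.1.le, hs.2⟩).symm
  · rw [hw ht, hw h0, hu.eq_integral t ht]
    congr 1
    refine intervalIntegral.integral_congr fun s hs => ?_
    rw [uIcc_of_le ht.1] at hs
    exact (hw' s ⟨hs.1, hs.2.trans ht.2⟩).symm

theorem mono (hu : IsPrimitiveOn T u u') {t : ℝ} (ht : t ∈ Icc 0 T) : IsPrimitiveOn t u u' := by
  refine ⟨hu.integrable.mono_set ?_, fun s hs => hu.eq_integral s ⟨hs.1, hs.2.trans ht.2⟩⟩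
  rw [uIcc_of_le ht.1, uIcc_of_le (ht.1.trans ht.2)]
  exact Icc_subset_Icc_right ht.2

theorem integrable_of_mem (hu : IsPrimitiveOn T u u') {t : ℝ} (ht : t ∈ Icc 0 T) :
    IntervalIntegrable u' volume 0 t := (hu.mono ht).integrable

theorem const (T c : ℝ) : IsPrimitiveOn T (fun _ => c) (fun _ => 0) :=
  ⟨by simp, by simp⟩

theorem add (hu : IsPrimitiveOn T u u') (hw : IsPrimitiveOn T w w') :
    IsPrimitiveOn T (fun s => u s + w s) (fun s => u' s + w' s) := by
  refine ⟨hu.integrable.add hw.integrable, fun t ht => ?_⟩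
  rw [intervalIntegral.integral_add (hu.integrable_of_mem ht) (hw.integrable_of_mem ht),
    hu.eq_integral t ht, hw.eq_integral t ht]
  ring

theorem sub (hu : IsPrimitiveOn T u u') (hw : IsPrimitiveOn T w w') :
    IsPrimitiveOn T (fun s => u s - w s) (fun s => u' s - w' s) := by
  refine ⟨hu.integrable.sub hw.integrable, fun t ht => ?_⟩
  rw [intervalIntegral.integral_sub (hu.integrable_of_mem ht) (hw.integrable_of_mem ht),
    hu.eq_integral t ht, hw.eq_integral t ht]
  ring

theorem sum {ι : Type*} (s : Finset ι) {f f' : ι → ℝ → ℝ}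
    (hf : ∀ i ∈ s, IsPrimitiveOn T (f i) (f' i)) :
    IsPrimitiveOn T (fun t => ∑ i ∈ s, f i t) (fun t => ∑ i ∈ s, f' i t) := by
  classical
  induction s using Finset.induction_on with
  | empty => simpa using const T 0
  | insert a s ha ih =>
    simp only [Finset.sum_insert ha]
    exact (hf a (Finset.mem_insert_self a s)).add
      (ih fun i hi => hf i (Finset.mem_insert_of_mem hi))

/-- The product rule. -/
theorem mul (hu : IsPrimitiveOn T u u') (hw : IsPrimitiveOn T w w') (hT : 0 ≤ T) :
    IsPrimitiveOn T (fun s => u s * w s) (fun s => u' s * w s + u s * w' s) := by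
  have cu := hu.continuousOn
  have cw := hw.continuousOn
  refine ⟨?_, fun t ht => ?_⟩
  · rw [← uIcc_of_le hT] at cu cw
    exact (hu.integrable.mul_continuousOn cw).add (hw.integrable.continuousOn_mul cu)
  -- Integration by parts is applied to the primitives themselves, since `u` and `w` are arbitrary
  -- outside `[0,T]`; almost everywhere their derivatives are `u'` and `w'`.
  have key : ∀ {f f' : ℝ → ℝ}, IsPrimitiveOn T f f' →
      AbsolutelyContinuousOnInterval (fun x => f 0 + ∫ s in (0 : ℝ)..x, f' s) 0 t := by
    intro f f' hf
    have h1 := ((hf.integrable_of_mem ht).absolutelyContinuousOnInterval_intervalIntegral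
      (c := 0) (by simp))
    have h2 : AbsolutelyContinuousOnInterval (fun _ : ℝ => f 0) 0 t :=
      (LipschitzOnWith.of_dist_le_mul (K := 0) (by simp)).absolutelyContinuousOnInterval
    exact h2.fun_add h1
  have h := (key hu).integral_deriv_mul_eq_sub (key hw)
  rw [← hu.eq_integral t ht, ← hw.eq_integral t ht] at h
  simp only [intervalIntegral.integral_same, add_zero] at h
  rw [eq_comm, sub_eq_iff_eq_add'] at h
  rw [h]
  congr 1
  apply intervalIntegral.integral_congr_ae
  filter_upwards [(hu.integrable_of_mem ht).ae_hasDerivAt_integral,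
    (hw.integrable_of_mem ht).ae_hasDerivAt_integral] with s hs1 hs2 hs
  have hs' : s ∈ uIcc 0 t := uIoc_subset_uIcc hs
  have hsT : s ∈ Icc 0 T := by
    rw [uIcc_of_le ht.1] at hs'
    exact ⟨hs'.1, hs'.2.trans ht.2⟩
  have d1 := ((hs1 hs' 0 (by simp)).const_add (u 0)).deriv
  have d2 := ((hs2 hs' 0 (by simp)).const_add (w 0)).deriv
  rw [d1, d2, ← hu.eq_integral s hsT, ← hw.eq_integral s hsT]

theorem of_hasDerivAt (hd : ∀ t ∈ Icc 0 T, HasDerivAt u (u' t) t)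
    (hc : ContinuousOn u' (Icc 0 T)) (hT : 0 ≤ T) : IsPrimitiveOn T u u' := by
  have hc' := hc
  rw [← uIcc_of_le hT] at hc'
  refine ⟨hc'.intervalIntegrable, fun t ht => ?_⟩
  have hst : uIcc 0 t ⊆ Icc 0 T := by rw [uIcc_of_le ht.1]; exact Icc_subset_Icc_right ht.2
  rw [intervalIntegral.integral_eq_sub_of_hasDerivAt (fun s hs => hd s (hst hs))
    (hc.mono hst).intervalIntegrable]
  ring

theorem dotProduct {d : ℕ} {x x' z z' : ℝ → Fin d → ℝ} (hT : 0 ≤ T)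
    (hx : ∀ i, IsPrimitiveOn T (fun s => x s i) (fun s => x' s i))
    (hz : ∀ i, IsPrimitiveOn T (fun s => z s i) (fun s => z' s i)) :
    IsPrimitiveOn T (fun s => x s ⬝ᵥ z s) (fun s => x' s ⬝ᵥ z s + x s ⬝ᵥ z' s) := by
  have h := sum Finset.univ fun i _ => (hx i).mul (hz i) hT
  simpa only [_root_.dotProduct, ← Finset.sum_add_distrib] using h

theorem mulVec {d e : ℕ} {M M' : ℝ → Matrix (Fin d) (Fin e) ℝ} {x x' : ℝ → Fin e → ℝ}
    (hT : 0 ≤ T) (hM : ∀ i j, IsPrimitiveOn T (fun s => M s i j) (fun s => M' s i j))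
    (hx : ∀ i, IsPrimitiveOn T (fun s => x s i) (fun s => x' s i)) (i : Fin d) :
    IsPrimitiveOn T (fun s => (M s *ᵥ x s) i) (fun s => (M' s *ᵥ x s + M s *ᵥ x' s) i) :=
  dotProduct hT (hM i) hx

end IsPrimitiveOn

theorem intervalIntegral_apply {d : ℕ} {f : ℝ → Fin d → ℝ} {a b : ℝ}
    (hf : IntervalIntegrable f volume a b) (i : Fin d) :
    (∫ s in a..b, f s) i = ∫ s in a..b, f s i :=
  ((ContinuousLinearMap.proj (R := ℝ) (φ := fun _ : Fin d => ℝ) i).intervalIntegral_comp_comm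
    hf).symm

theorem intervalIntegrable_pi {d : ℕ} {f : ℝ → Fin d → ℝ} {a b : ℝ} :
    IntervalIntegrable f volume a b ↔ ∀ i, IntervalIntegrable (fun s => f s i) volume a b := by
  simp only [intervalIntegrable_iff, IntegrableOn]
  exact ⟨fun h i => h.eval i, fun h => Integrable.of_eval h⟩

/-- A vector-valued integral equation, componentwise. -/
theorem isPrimitiveOn_apply {d : ℕ} {T : ℝ} {f f' : ℝ → Fin d → ℝ}
    (hf : IntervalIntegrable f' volume 0 T)
    (h : ∀ t ∈ Icc 0 T, f t = f 0 + ∫ s in (0 : ℝ)..t, f' s) (i : Fin d) :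
    IsPrimitiveOn T (fun s => f s i) (fun s => f' s i) := by
  refine ⟨intervalIntegrable_pi.1 hf i, fun t ht => ?_⟩
  rw [h t ht, Pi.add_apply, intervalIntegral_apply]
  refine hf.mono_set ?_
  rw [uIcc_of_le ht.1, uIcc_of_le (ht.1.trans ht.2)]
  exact Icc_subset_Icc_right ht.2

theorem eq_integral_of_isPrimitiveOn {d : ℕ} {T : ℝ} {f f' : ℝ → Fin d → ℝ}
    (h : ∀ i, IsPrimitiveOn T (fun s => f s i) (fun s => f' s i)) {t : ℝ} (ht : t ∈ Icc 0 T) :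
    f t = f 0 + ∫ s in (0 : ℝ)..t, f' s := by
  ext i
  rw [Pi.add_apply, intervalIntegral_apply
    (intervalIntegrable_pi.2 fun i => (h i).integrable_of_mem ht)]
  exact (h i).eq_integral t ht

/-! ### The Hamiltonian flow -/

/-- The parameters `(A, Γ, R, W)` of a system, where `W` is the inverse of `Q`. -/
abbrev Coeffs (n m r : ℕ) : Type :=
  Matrix (Fin n) (Fin n) ℝ × Matrix (Fin n) (Fin n) ℝ ×
    Matrix (Fin m) (Fin m) ℝ × Matrix (Fin r) (Fin r) ℝ

/-- The coefficients of a system. -/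
def Sys.coeffs (S : Sys n m r) : Coeffs n m r := (S.A, S.Γ, S.R, S.Q⁻¹)

/-! ### Differentiation of matrix-valued functions -/

section Linear

variable {E G : Type*} [NormedAddCommGroup E] [NormedSpace ℝ E] [FiniteDimensional ℝ E]
  [NormedAddCommGroup G] [NormedSpace ℝ G]

theorem hasDerivAt_linearMap_comp (L : E →ₗ[ℝ] G) {f : ℝ → E} {f' : E} {t : ℝ}
    (hf : HasDerivAt f f' t) : HasDerivAt (fun s => L (f s)) (L f') t :=
  (LinearMap.toContinuousLinearMap L).hasFDerivAt.comp_hasDerivAt t hf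

theorem contDiff_linearMap (L : E →ₗ[ℝ] G) {k : WithTop ℕ∞} : ContDiff ℝ k L :=
  (LinearMap.toContinuousLinearMap L).contDiff

end Linear

theorem hasDerivAt_transpose {d e : ℕ} {f : ℝ → Matrix (Fin d) (Fin e) ℝ}
    {f' : Matrix (Fin d) (Fin e) ℝ} {t : ℝ}
    (hf : HasDerivAt f f' t) : HasDerivAt (fun s => (f s)ᵀ) f'ᵀ t :=
  hasDerivAt_linearMap_comp (Matrix.transposeLinearEquiv (Fin d) (Fin e) ℝ ℝ).toLinearMap hf

theorem hasDerivAt_entry {d e : ℕ} {f : ℝ → Matrix (Fin d) (Fin e) ℝ}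
    {f' : Matrix (Fin d) (Fin e) ℝ} {t : ℝ}
    (hf : HasDerivAt f f' t) (i : Fin d) (j : Fin e) : HasDerivAt (fun s => f s i j) (f' i j) t :=
  hasDerivAt_linearMap_comp (Matrix.entryLinearMap ℝ ℝ i j) hf

theorem hasDerivAt_quadForm {d e : ℕ} {f : ℝ → Matrix (Fin d) (Fin e) ℝ}
    {f' : Matrix (Fin d) (Fin e) ℝ} {t : ℝ}
    (hf : HasDerivAt f f' t) (u : Fin d → ℝ) (v : Fin e → ℝ) :
    HasDerivAt (fun s => u ⬝ᵥ (f s *ᵥ v)) (u ⬝ᵥ (f' *ᵥ v)) t :=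
  hasDerivAt_linearMap_comp (E := Matrix (Fin d) (Fin e) ℝ)
    { toFun := fun M => u ⬝ᵥ (M *ᵥ v)
      map_add' := fun M N => by rw [Matrix.add_mulVec, dotProduct_add]
      map_smul' := fun c M => by simp [Matrix.smul_mulVec, dotProduct_smul] } hf

theorem hasDerivAt_matrix_inv {d : ℕ} {f : ℝ → Matrix (Fin d) (Fin d) ℝ}
    {f' : Matrix (Fin d) (Fin d) ℝ} {t : ℝ} (hf : HasDerivAt f f' t) (hu : IsUnit (f t)) :
    HasDerivAt (fun s => (f s)⁻¹) (-((f t)⁻¹ * f' * (f t)⁻¹)) t := by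
  obtain ⟨U, hU⟩ := hu
  have h := (hasFDerivAt_ringInverse (𝕜 := ℝ) U)
  rw [hU] at h
  have h2 := h.comp_hasDerivAt t hf
  have e : (↑U⁻¹ : Matrix (Fin d) (Fin d) ℝ) = (f t)⁻¹ := by
    rw [← hU, Matrix.coe_units_inv]
  simp only [e] at h2
  convert! h2 using 1
  · ext1 s; simp [Matrix.nonsing_inv_eq_ringInverse]

/-- The Hamiltonian matrix of the Riccati equation, a linear function of the coefficients. -/
def hamiltonian (F : Setup n m r) :
    Coeffs n m r →ₗ[ℝ] Matrix (Fin n ⊕ Fin n) (Fin n ⊕ Fin n) ℝ where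
  toFun θ := Matrix.fromBlocks (-θ.1ᵀ) (F.Cᵀ * θ.2.2.2 * F.C) (F.B * θ.2.2.1 * F.Bᵀ) θ.1
  map_add' θ η := by
    simp only [Prod.fst_add, Prod.snd_add, Matrix.fromBlocks_add, Matrix.transpose_add, neg_add,
      Matrix.mul_add, Matrix.add_mul]
  map_smul' c θ := by
    simp [Matrix.fromBlocks_smul]

/-- The block `X` of the solution of the Hamiltonian system with initial value `(1, Γ)`. -/
def flowX (F : Setup n m r) (θ : Coeffs n m r) (t : ℝ) : Matrix (Fin n) (Fin n) ℝ :=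
  (NormedSpace.exp (t • hamiltonian F θ)).toBlocks₁₁
    + (NormedSpace.exp (t • hamiltonian F θ)).toBlocks₁₂ * θ.2.1

/-- The block `Y` of the solution of the Hamiltonian system with initial value `(1, Γ)`. -/
def flowY (F : Setup n m r) (θ : Coeffs n m r) (t : ℝ) : Matrix (Fin n) (Fin n) ℝ :=
  (NormedSpace.exp (t • hamiltonian F θ)).toBlocks₂₁
    + (NormedSpace.exp (t • hamiltonian F θ)).toBlocks₂₂ * θ.2.1

section Flow

variable (F : Setup n m r) (θ : Coeffs n m r)

@[simp] theorem flowX_zero : flowX F θ 0 = 1 := by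
  simp only [flowX, zero_smul, NormedSpace.exp_zero, ← Matrix.fromBlocks_one,
    Matrix.toBlocks_fromBlocks₁₁, Matrix.toBlocks_fromBlocks₁₂, zero_mul, add_zero]

@[simp] theorem flowY_zero : flowY F θ 0 = θ.2.1 := by
  simp only [flowY, zero_smul, NormedSpace.exp_zero, ← Matrix.fromBlocks_one,
    Matrix.toBlocks_fromBlocks₂₁, Matrix.toBlocks_fromBlocks₂₂, one_mul, zero_add]

/-- Taking a block, as a linear map. -/
def blockMap (f g : Fin n → Fin n ⊕ Fin n) :
    Matrix (Fin n ⊕ Fin n) (Fin n ⊕ Fin n) ℝ →ₗ[ℝ] Matrix (Fin n) (Fin n) ℝ where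
  toFun M := M.submatrix f g
  map_add' _ _ := rfl
  map_smul' _ _ := rfl

theorem hasDerivAt_flowX (t : ℝ) :
    HasDerivAt (flowX F θ)
      (-θ.1ᵀ * flowX F θ t + F.Cᵀ * θ.2.2.2 * F.C * flowY F θ t) t := by
  have h := hasDerivAt_exp_smul_const' (𝕂 := ℝ) (hamiltonian F θ) t
  have h1 := hasDerivAt_linearMap_comp (blockMap Sum.inl Sum.inl) h
  have h2 := hasDerivAt_linearMap_comp (blockMap Sum.inl Sum.inr) h
  convert! h1.add (h2.mul_const θ.2.1) using 1
  obtain ⟨a, b, c, d, hE⟩ : ∃ a b c d : Matrix (Fin n) (Fin n) ℝ,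
      NormedSpace.exp (t • hamiltonian F θ) = Matrix.fromBlocks a b c d :=
    ⟨_, _, _, _, (Matrix.fromBlocks_toBlocks _).symm⟩
  have e1 : ∀ M, blockMap (n := n) Sum.inl Sum.inl M = M.toBlocks₁₁ := fun _ => rfl
  have e2 : ∀ M, blockMap (n := n) Sum.inl Sum.inr M = M.toBlocks₁₂ := fun _ => rfl
  rw [e1, e2, flowX, flowY, hE]
  simp only [hamiltonian, LinearMap.coe_mk, AddHom.coe_mk, Matrix.fromBlocks_multiply,
    Matrix.toBlocks_fromBlocks₁₁, Matrix.toBlocks_fromBlocks₁₂, Matrix.toBlocks_fromBlocks₂₁,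
    Matrix.toBlocks_fromBlocks₂₂]
  noncomm_ring

theorem hasDerivAt_flowY (t : ℝ) :
    HasDerivAt (flowY F θ)
      (F.B * θ.2.2.1 * F.Bᵀ * flowX F θ t + θ.1 * flowY F θ t) t := by
  have h := hasDerivAt_exp_smul_const' (𝕂 := ℝ) (hamiltonian F θ) t
  have h1 := hasDerivAt_linearMap_comp (blockMap Sum.inr Sum.inl) h
  have h2 := hasDerivAt_linearMap_comp (blockMap Sum.inr Sum.inr) h
  convert! h1.add (h2.mul_const θ.2.1) using 1
  obtain ⟨a, b, c, d, hE⟩ : ∃ a b c d : Matrix (Fin n) (Fin n) ℝ,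
      NormedSpace.exp (t • hamiltonian F θ) = Matrix.fromBlocks a b c d :=
    ⟨_, _, _, _, (Matrix.fromBlocks_toBlocks _).symm⟩
  have e1 : ∀ M, blockMap (n := n) Sum.inr Sum.inl M = M.toBlocks₂₁ := fun _ => rfl
  have e2 : ∀ M, blockMap (n := n) Sum.inr Sum.inr M = M.toBlocks₂₂ := fun _ => rfl
  rw [e1, e2, flowX, flowY, hE]
  simp only [hamiltonian, LinearMap.coe_mk, AddHom.coe_mk, Matrix.fromBlocks_multiply,
    Matrix.toBlocks_fromBlocks₁₁, Matrix.toBlocks_fromBlocks₁₂, Matrix.toBlocks_fromBlocks₂₁,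
    Matrix.toBlocks_fromBlocks₂₂]
  noncomm_ring

theorem continuous_flowX : Continuous (flowX F θ) :=
  continuous_iff_continuousAt.2 fun t => (hasDerivAt_flowX F θ t).continuousAt

theorem continuous_flowY : Continuous (flowY F θ) :=
  continuous_iff_continuousAt.2 fun t => (hasDerivAt_flowY F θ t).continuousAt

end Flow

/-- The coefficients of a system with covariances; `R` and `W` may be degenerate. -/
structure Coeffs.Admissible (θ : Coeffs n m r) : Prop where
  posDef : θ.2.1.PosDef
  posSemidef_R : θ.2.2.1.PosSemidef
  posSemidef_W : θ.2.2.2.PosSemidef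

namespace Coeffs.Admissible

variable {F : Setup n m r} {θ : Coeffs n m r}

theorem transpose_Γ (h : θ.Admissible) : θ.2.1ᵀ = θ.2.1 := h.posDef.isHermitian
theorem transpose_R (h : θ.Admissible) : θ.2.2.1ᵀ = θ.2.2.1 := h.posSemidef_R.isHermitian
theorem transpose_W (h : θ.Admissible) : θ.2.2.2ᵀ = θ.2.2.2 := h.posSemidef_W.isHermitian

/-- The terms with `A` cancel; only two positive semidefinite terms remain. -/
theorem hasDerivAt_gram (h : θ.Admissible) (t : ℝ) :
    HasDerivAt (fun s => (flowX F θ s)ᵀ * flowY F θ s)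
      ((flowY F θ t)ᵀ * (F.Cᵀ * θ.2.2.2 * F.C) * flowY F θ t
        + (flowX F θ t)ᵀ * (F.B * θ.2.2.1 * F.Bᵀ) * flowX F θ t) t := by
  have h1 := (hasDerivAt_transpose (hasDerivAt_flowX F θ t)).mul (hasDerivAt_flowY F θ t)
  convert! h1 using 1
  simp only [Matrix.transpose_add, Matrix.transpose_mul, Matrix.transpose_neg,
    Matrix.transpose_transpose, h.transpose_W, Matrix.mul_assoc]
  simp only [← Matrix.mul_assoc, Matrix.add_mul, Matrix.mul_add, Matrix.neg_mul, Matrix.mul_neg]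
  abel

/-- The derivative of `Xᵀ Y` is symmetric, so its antisymmetric part is constant, and it vanishes at
time `0` because `Γ` is symmetric. -/
theorem gram_symm (h : θ.Admissible) (t : ℝ) :
    (flowY F θ t)ᵀ * flowX F θ t = (flowX F θ t)ᵀ * flowY F θ t := by
  have hd : ∀ s, HasDerivAt (fun s => (flowY F θ s)ᵀ * flowX F θ s
      - (flowX F θ s)ᵀ * flowY F θ s) 0 s := by
    intro s
    have h1 := h.hasDerivAt_gram (F := F) s
    have h2 := hasDerivAt_transpose h1
    convert! h2.sub h1 using 1
    · ext1 s; simp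
    · simp only [Matrix.transpose_add, Matrix.transpose_mul,
        Matrix.transpose_transpose, h.transpose_W, h.transpose_R, Matrix.mul_assoc]
      abel
  have h0 := is_const_of_deriv_eq_zero (fun s => (hd s).differentiableAt)
    (fun s => (hd s).deriv) t 0
  simpa [sub_eq_zero, h.transpose_Γ] using h0

theorem gram_pos (h : θ.Admissible) {t : ℝ} (ht : 0 ≤ t) {u : Fin n → ℝ} (hu : u ≠ 0) :
    0 < u ⬝ᵥ (((flowX F θ t)ᵀ * flowY F θ t) *ᵥ u) := by
  have hq := fun s => hasDerivAt_quadForm (h.hasDerivAt_gram (F := F) s) u u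
  have hm : Monotone fun s => u ⬝ᵥ (((flowX F θ s)ᵀ * flowY F θ s) *ᵥ u) := by
    refine monotone_of_deriv_nonneg (fun s => (hq s).differentiableAt) fun s => ?_
    rw [(hq s).deriv, Matrix.add_mulVec, dotProduct_add]
    have p1 := ((h.posSemidef_W.conjTranspose_mul_mul_same F.C).conjTranspose_mul_mul_same
      (flowY F θ s)).dotProduct_mulVec_nonneg u
    have p2 := ((h.posSemidef_R.mul_mul_conjTranspose_same F.B).conjTranspose_mul_mul_same
      (flowX F θ s)).dotProduct_mulVec_nonneg u
    simp only [Matrix.conjTranspose_eq_transpose_of_trivial, star_trivial] at p1 p2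
    exact add_nonneg p1 p2
  have h0 := hm ht
  have h1 := h.posDef.dotProduct_mulVec_pos hu
  simp only [flowX_zero, flowY_zero, Matrix.transpose_one, Matrix.one_mul, star_trivial] at h0 h1
  exact h1.trans_le h0

/-- A kernel vector `u` of `X` would give `uᵀ Xᵀ Y u = uᵀ Yᵀ X u = 0`, against `gram_pos`. This is
what excludes blow-up of the Riccati solution in forward time. -/
theorem isUnit_flowX (h : θ.Admissible) {t : ℝ} (ht : 0 ≤ t) : IsUnit (flowX F θ t) := by
  rw [← Matrix.mulVec_injective_iff_isUnit]
  refine (injective_iff_map_eq_zero (Matrix.mulVecLin (flowX F θ t))).2 fun u hu => ?_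
  by_contra hne
  have := h.gram_pos (F := F) ht hne
  rw [← h.gram_symm, ← Matrix.mulVec_mulVec] at this
  rw [Matrix.mulVecLin_apply] at hu
  simp [hu] at this

theorem isUnit_flowY (h : θ.Admissible) {t : ℝ} (ht : 0 ≤ t) : IsUnit (flowY F θ t) := by
  rw [← Matrix.mulVec_injective_iff_isUnit]
  refine (injective_iff_map_eq_zero (Matrix.mulVecLin (flowY F θ t))).2 fun u hu => ?_
  by_contra hne
  have := h.gram_pos (F := F) ht hne
  rw [← Matrix.mulVec_mulVec] at this
  rw [Matrix.mulVecLin_apply] at hu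
  simp [hu] at this

end Coeffs.Admissible

/-- The solution of the Riccati equation. -/
def flowCov (F : Setup n m r) (θ : Coeffs n m r) (t : ℝ) : Matrix (Fin n) (Fin n) ℝ :=
  flowY F θ t * (flowX F θ t)⁻¹

/-- The inverse of the solution of the Riccati equation. -/
def flowPrec (F : Setup n m r) (θ : Coeffs n m r) (t : ℝ) : Matrix (Fin n) (Fin n) ℝ :=
  flowX F θ t * (flowY F θ t)⁻¹

/-! ### Covariance and precision along the flow -/

namespace Coeffs.Admissible

variable {F : Setup n m r} {θ : Coeffs n m r} {t : ℝ}

theorem flowX_mul_inv (h : θ.Admissible) (ht : 0 ≤ t) : flowX F θ t * (flowX F θ t)⁻¹ = 1 :=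
  Matrix.mul_nonsing_inv _ ((Matrix.isUnit_iff_isUnit_det _).1 (h.isUnit_flowX ht))

theorem flowX_inv_mul (h : θ.Admissible) (ht : 0 ≤ t) : (flowX F θ t)⁻¹ * flowX F θ t = 1 :=
  Matrix.nonsing_inv_mul _ ((Matrix.isUnit_iff_isUnit_det _).1 (h.isUnit_flowX ht))

theorem flowY_mul_inv (h : θ.Admissible) (ht : 0 ≤ t) : flowY F θ t * (flowY F θ t)⁻¹ = 1 :=
  Matrix.mul_nonsing_inv _ ((Matrix.isUnit_iff_isUnit_det _).1 (h.isUnit_flowY ht))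

theorem flowY_inv_mul (h : θ.Admissible) (ht : 0 ≤ t) : (flowY F θ t)⁻¹ * flowY F θ t = 1 :=
  Matrix.nonsing_inv_mul _ ((Matrix.isUnit_iff_isUnit_det _).1 (h.isUnit_flowY ht))

theorem flowCov_mul_flowX (h : θ.Admissible) (ht : 0 ≤ t) :
    flowCov F θ t * flowX F θ t = flowY F θ t := by
  rw [flowCov, Matrix.mul_assoc, h.flowX_inv_mul ht, Matrix.mul_one]

theorem flowPrec_mul_flowY (h : θ.Admissible) (ht : 0 ≤ t) :
    flowPrec F θ t * flowY F θ t = flowX F θ t := by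
  rw [flowPrec, Matrix.mul_assoc, h.flowY_inv_mul ht, Matrix.mul_one]

theorem flowCov_mul_flowPrec (h : θ.Admissible) (ht : 0 ≤ t) :
    flowCov F θ t * flowPrec F θ t = 1 := by
  rw [flowPrec, ← Matrix.mul_assoc, h.flowCov_mul_flowX ht, h.flowY_mul_inv ht]

theorem flowPrec_mul_flowCov (h : θ.Admissible) (ht : 0 ≤ t) :
    flowPrec F θ t * flowCov F θ t = 1 := by
  rw [flowCov, ← Matrix.mul_assoc, h.flowPrec_mul_flowY ht, h.flowX_mul_inv ht]

theorem flowCov_inv (h : θ.Admissible) (ht : 0 ≤ t) : (flowCov F θ t)⁻¹ = flowPrec F θ t :=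
  Matrix.inv_eq_right_inv (h.flowCov_mul_flowPrec ht)

/-- `Π = X⁻ᵀ (Xᵀ Y) X⁻¹` is congruent to the positive definite matrix `Xᵀ Y`. -/
theorem flowCov_posDef (h : θ.Admissible) (ht : 0 ≤ t) : (flowCov F θ t).PosDef := by
  have hg : ((flowX F θ t)ᵀ * flowY F θ t).PosDef := by
    refine Matrix.PosDef.of_dotProduct_mulVec_pos ?_ fun u hu => ?_
    · rw [Matrix.IsHermitian, Matrix.conjTranspose_eq_transpose_of_trivial,
        Matrix.transpose_mul, Matrix.transpose_transpose, h.gram_symm]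
    · simpa using h.gram_pos (F := F) ht hu
  have h2 := hg.conjTranspose_mul_mul_same (B := (flowX F θ t)⁻¹) (by
    rw [Matrix.mulVec_injective_iff_isUnit, Matrix.isUnit_nonsing_inv_iff]
    exact h.isUnit_flowX ht)
  convert h2 using 1
  rw [Matrix.conjTranspose_eq_transpose_of_trivial, ← Matrix.mul_assoc, ← Matrix.transpose_mul,
    h.flowX_mul_inv ht, Matrix.transpose_one, Matrix.one_mul, flowCov]

theorem flowPrec_posDef (h : θ.Admissible) (ht : 0 ≤ t) : (flowPrec F θ t).PosDef := by
  rw [← h.flowCov_inv ht]; exact (h.flowCov_posDef ht).inv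

theorem transpose_flowCov (h : θ.Admissible) (ht : 0 ≤ t) : (flowCov F θ t)ᵀ = flowCov F θ t :=
  (h.flowCov_posDef ht).isHermitian

theorem transpose_flowPrec (h : θ.Admissible) (ht : 0 ≤ t) :
    (flowPrec F θ t)ᵀ = flowPrec F θ t :=
  (h.flowPrec_posDef ht).isHermitian

theorem transpose_flowX_mul_flowCov (h : θ.Admissible) (ht : 0 ≤ t) :
    (flowX F θ t)ᵀ * flowCov F θ t = (flowY F θ t)ᵀ := by
  rw [← h.flowCov_mul_flowX (F := F) ht, Matrix.transpose_mul, h.transpose_flowCov ht]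

theorem hasDerivAt_flowCov (h : θ.Admissible) (ht : 0 ≤ t) :
    HasDerivAt (flowCov F θ) (θ.1 * flowCov F θ t + flowCov F θ t * θ.1ᵀ
      - flowCov F θ t * F.Cᵀ * θ.2.2.2 * F.C * flowCov F θ t + F.B * θ.2.2.1 * F.Bᵀ) t := by
  have h1 := (hasDerivAt_flowY F θ t).mul
    (hasDerivAt_matrix_inv (hasDerivAt_flowX F θ t) (h.isUnit_flowX ht))
  convert! h1 using 1
  rw [← h.flowCov_mul_flowX ht]
  have hc : ∀ M, flowX F θ t * ((flowX F θ t)⁻¹ * M) = M := fun M => by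
    rw [← Matrix.mul_assoc, h.flowX_mul_inv ht, Matrix.one_mul]
  simp only [Matrix.add_mul, Matrix.mul_add, Matrix.neg_mul, Matrix.mul_neg, neg_add, neg_neg,
    Matrix.mul_assoc, h.flowX_mul_inv ht, Matrix.mul_one, hc]
  abel

theorem hasDerivAt_flowPrec (h : θ.Admissible) (ht : 0 ≤ t) :
    HasDerivAt (flowPrec F θ) (-(θ.1ᵀ * flowPrec F θ t) - flowPrec F θ t * θ.1
      + F.Cᵀ * θ.2.2.2 * F.C
      - flowPrec F θ t * (F.B * θ.2.2.1 * F.Bᵀ) * flowPrec F θ t) t := by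
  have h1 := (hasDerivAt_flowX F θ t).mul
    (hasDerivAt_matrix_inv (hasDerivAt_flowY F θ t) (h.isUnit_flowY ht))
  convert! h1 using 1
  rw [← h.flowPrec_mul_flowY ht]
  have hc : ∀ M, flowY F θ t * ((flowY F θ t)⁻¹ * M) = M := fun M => by
    rw [← Matrix.mul_assoc, h.flowY_mul_inv ht, Matrix.one_mul]
  simp only [Matrix.add_mul, Matrix.mul_add, Matrix.neg_mul, Matrix.mul_neg, neg_add,
    Matrix.mul_assoc, h.flowY_mul_inv ht, Matrix.mul_one, hc]
  abel

theorem continuousOn_flowCov (h : θ.Admissible) : ContinuousOn (flowCov F θ) (Ici 0) :=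
  fun _ ht => (h.hasDerivAt_flowCov ht).continuousAt.continuousWithinAt

theorem continuousOn_flowPrec (h : θ.Admissible) : ContinuousOn (flowPrec F θ) (Ici 0) :=
  fun _ ht => (h.hasDerivAt_flowPrec ht).continuousAt.continuousWithinAt

end Coeffs.Admissible

/-! ### Well-posedness of the Riccati equation and of the filter equation -/

theorem continuousOn_entry {d e : ℕ} {f : ℝ → Matrix (Fin d) (Fin e) ℝ} {s : Set ℝ}
    (hf : ContinuousOn f s) (i : Fin d) (j : Fin e) : ContinuousOn (fun t => f t i j) s :=
  (LinearMap.toContinuousLinearMap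
    (Matrix.entryLinearMap ℝ ℝ i j)).continuous.comp_continuousOn hf

theorem intervalIntegrable_mulVec {d e : ℕ} {M : ℝ → Matrix (Fin d) (Fin e) ℝ}
    {f : ℝ → Fin e → ℝ} {T : ℝ} (hT : 0 ≤ T) (hM : ContinuousOn M (Icc 0 T))
    (hf : IntervalIntegrable f volume 0 T) :
    IntervalIntegrable (fun s => M s *ᵥ f s) volume 0 T := by
  rw [intervalIntegrable_pi] at hf ⊢
  intro i
  have h := IntervalIntegrable.sum Finset.univ (f := fun j s => M s i j * f s j)
    (fun j _ => (hf j).continuousOn_mul (by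
      rw [uIcc_of_le hT]; exact continuousOn_entry hM i j))
  simpa [Matrix.mulVec, dotProduct, Finset.sum_fn] using h

theorem isPrimitiveOn_entry {d e : ℕ} {M M' : ℝ → Matrix (Fin d) (Fin e) ℝ} {T : ℝ} (hT : 0 ≤ T)
    (hM : ∀ t ∈ Icc 0 T, HasDerivAt M (M' t) t) (hM' : ContinuousOn M' (Icc 0 T))
    (i : Fin d) (j : Fin e) : IsPrimitiveOn T (fun s => M s i j) (fun s => M' s i j) :=
  IsPrimitiveOn.of_hasDerivAt (fun t ht => hasDerivAt_entry (hM t ht) i j)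
    (continuousOn_entry hM' i j) hT

theorem Setup.intervalIntegrable_y (F : Setup n m r) : IntervalIntegrable F.y volume 0 F.T := by
  rw [intervalIntegrable_iff_integrableOn_Ioo_of_le F.T_pos.le]
  exact F.y_memLp.integrable (by norm_num)

theorem isRiccatiSol_flowCov {F : Setup n m r} {S : Sys n m r} (h : S.coeffs.Admissible) :
    IsRiccatiSol F S (flowCov F S.coeffs) where
  continuousOn := h.continuousOn_flowCov.mono fun _ ht => ht.1
  initial := by simp [flowCov, Sys.coeffs]
  deriv t ht := h.hasDerivAt_flowCov ht.1.le

/-- For any solution `P`, the defect `Z = Y - P X` solves the linear equation `Z' = (A - P Cᵀ Q⁻¹ C)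
Z` with `Z(0) = 0`, so it vanishes by Grönwall. -/
theorem IsRiccatiSol.eqOn_flowCov {F : Setup n m r} {S : Sys n m r} (h : S.coeffs.Admissible)
    {P : ℝ → Matrix (Fin n) (Fin n) ℝ} (hP : IsRiccatiSol F S P) :
    EqOn P (flowCov F S.coeffs) (Icc 0 F.T) := by
  set X := flowX F S.coeffs with hX
  set Y := flowY F S.coeffs with hY
  have cX : Continuous X := continuous_flowX F _
  have cY : Continuous Y := continuous_flowY F _
  set K : ℝ → Matrix (Fin n) (Fin n) ℝ := fun t => S.A - P t * (F.Cᵀ * S.Q⁻¹ * F.C) with hK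
  have cK : ContinuousOn K (Icc 0 F.T) :=
    continuousOn_const.sub (hP.continuousOn.mul continuousOn_const)
  set Z : ℝ → Matrix (Fin n) (Fin n) ℝ := fun t => Y t - P t * X t with hZ
  have cZ : ContinuousOn Z (Icc 0 F.T) :=
    cY.continuousOn.sub (hP.continuousOn.mul cX.continuousOn)
  have hZ0 : Z 0 = 0 := by simp [hZ, hX, hY, hP.initial, Sys.coeffs]
  have dZ : ∀ t ∈ Ioo 0 F.T, HasDerivAt Z (K t * Z t) t := by
    intro t ht
    have h1 := (hasDerivAt_flowY F S.coeffs t).sub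
      ((hP.deriv t ht).mul (hasDerivAt_flowX F S.coeffs t))
    convert! h1 using 1
    simp only [hK, hZ, hX, hY, Sys.coeffs, Matrix.sub_mul, Matrix.mul_sub, Matrix.add_mul,
      Matrix.mul_add, Matrix.mul_assoc, Matrix.neg_mul, Matrix.mul_neg]
    abel
  -- The Riccati equation is only assumed on the open interval; the right derivative at `0` is
  -- recovered as a limit of derivatives.
  have d0 : HasDerivWithinAt Z (K 0 * Z 0) (Ici 0) 0 := by
    refine hasDerivWithinAt_Ici_of_tendsto_deriv (s := Ioo 0 F.T)
      (fun t ht => (dZ t ht).differentiableAt.differentiableWithinAt)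
      ((cZ 0 ⟨le_rfl, F.T_pos.le⟩).mono Ioo_subset_Icc_self) (Ioo_mem_nhdsGT F.T_pos) ?_
    have hc : ContinuousWithinAt (fun t => K t * Z t) (Ioo 0 F.T) 0 :=
      ((cK.mul cZ) 0 ⟨le_rfl, F.T_pos.le⟩).mono Ioo_subset_Icc_self
    rw [ContinuousWithinAt, nhdsWithin_Ioo_eq_nhdsGT F.T_pos] at hc
    refine hc.congr' ?_
    filter_upwards [Ioo_mem_nhdsGT F.T_pos] with t ht using (dZ t ht).deriv.symm
  obtain ⟨C, hC⟩ := isCompact_Icc.exists_bound_of_continuousOn cK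
  have hz := eq_zero_of_abs_deriv_le_mul_abs_self_of_eq_zero_right (K := C) cZ
    (f' := fun t => K t * Z t) (fun t ht => by
      rcases ht.1.eq_or_lt with h0 | h0
      · rw [← h0]; exact d0
      · exact (dZ t ⟨h0, ht.2⟩).hasDerivWithinAt) hZ0
    (fun t ht => (norm_mul_le _ _).trans
      (mul_le_mul_of_nonneg_right (hC t ⟨ht.1, ht.2.le⟩) (norm_nonneg _)))
  intro t ht
  have h1 := sub_eq_zero.1 (hz t ht)
  rw [flowCov, ← hY, ← hX, h1, Matrix.mul_assoc, h.flowX_mul_inv ht.1, Matrix.mul_one]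

theorem isRiccatiSol_errorCov {F : Setup n m r} {S : Sys n m r} (h : S.coeffs.Admissible) :
    IsRiccatiSol F S (errorCov F S) :=
  Classical.epsilon_spec (p := IsRiccatiSol F S) ⟨_, isRiccatiSol_flowCov h⟩

theorem errorCov_eq {F : Setup n m r} {S : Sys n m r} (h : S.coeffs.Admissible) {t : ℝ}
    (ht : t ∈ Icc 0 F.T) : errorCov F S t = flowCov F S.coeffs t :=
  (isRiccatiSol_errorCov h).eqOn_flowCov h ht

theorem precision_eq {F : Setup n m r} {S : Sys n m r} (h : S.coeffs.Admissible) {t : ℝ}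
    (ht : t ∈ Icc 0 F.T) : precision F S t = flowPrec F S.coeffs t := by
  rw [precision, errorCov_eq h ht, h.flowCov_inv ht.1]

/-- The integrated, transformed output `x₀ + ∫ Yᵀ Cᵀ W y`. -/
def flowOutput (F : Setup n m r) (θ : Coeffs n m r) (t : ℝ) : Fin n → ℝ :=
  F.x₀ + ∫ s in (0 : ℝ)..t, ((flowY F θ s)ᵀ * F.Cᵀ * θ.2.2.2) *ᵥ F.y s

/-- The solution of the filter equation. -/
def flowFilter (F : Setup n m r) (θ : Coeffs n m r) (t : ℝ) : Fin n → ℝ :=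
  ((flowX F θ t)⁻¹)ᵀ *ᵥ flowOutput F θ t

theorem continuous_matrix_mul {d e f : ℕ} :
    Continuous fun p : Matrix (Fin d) (Fin e) ℝ × Matrix (Fin e) (Fin f) ℝ => p.1 * p.2 :=
  Continuous.matrix_mul continuous_fst continuous_snd

theorem intervalIntegrable_flowOutput (F : Setup n m r) (θ : Coeffs n m r) :
    IntervalIntegrable (fun s => ((flowY F θ s)ᵀ * F.Cᵀ * θ.2.2.2) *ᵥ F.y s) volume 0 F.T := by
  refine intervalIntegrable_mulVec F.T_pos.le (Continuous.continuousOn ?_) F.intervalIntegrable_y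
  exact ((continuous_flowY F θ).matrix_transpose.matrix_mul continuous_const).matrix_mul
    continuous_const

theorem isPrimitiveOn_flowOutput (F : Setup n m r) (θ : Coeffs n m r) (i : Fin n) :
    IsPrimitiveOn F.T (fun t => flowOutput F θ t i)
      (fun s => (((flowY F θ s)ᵀ * F.Cᵀ * θ.2.2.2) *ᵥ F.y s) i) :=
  isPrimitiveOn_apply (intervalIntegrable_flowOutput F θ) (by simp [flowOutput]) i

/-- The right hand side of the filter equation. -/
def flowFilterDeriv (F : Setup n m r) (θ : Coeffs n m r) (x : ℝ → Fin n → ℝ) (s : ℝ) :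
    Fin n → ℝ :=
  θ.1 *ᵥ x s + (flowCov F θ s * F.Cᵀ * θ.2.2.2) *ᵥ (F.y s - F.C *ᵥ x s)

/-- Variation of constants: `X⁻ᵀ` is the fundamental matrix of the homogeneous filter equation, with
generator `A - Π Cᵀ W C`. -/
theorem Coeffs.Admissible.isPrimitiveOn_flowFilter {F : Setup n m r} {θ : Coeffs n m r}
    (h : θ.Admissible) (i : Fin n) :
    IsPrimitiveOn F.T (fun t => flowFilter F θ t i)
      (fun s => flowFilterDeriv F θ (flowFilter F θ) s i) := by
  have hT := F.T_pos.le
  have d1 : ∀ t ∈ Icc 0 F.T, HasDerivAt (fun s => ((flowX F θ s)⁻¹)ᵀ)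
      ((θ.1 - flowCov F θ t * (F.Cᵀ * θ.2.2.2 * F.C)) * ((flowX F θ t)⁻¹)ᵀ) t := by
    intro t ht
    have h1 := hasDerivAt_transpose
      (hasDerivAt_matrix_inv (hasDerivAt_flowX F θ t) (h.isUnit_flowX ht.1))
    convert! h1 using 1
    rw [← h.transpose_flowCov ht.1]
    apply Matrix.transpose_injective
    simp only [flowCov, Matrix.transpose_mul, Matrix.transpose_sub, Matrix.transpose_transpose,
      Matrix.mul_add, Matrix.add_mul, Matrix.mul_neg, Matrix.neg_mul, neg_add, neg_neg,
      Matrix.mul_assoc, Matrix.sub_mul, h.transpose_W]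
    rw [h.flowX_mul_inv ht.1, Matrix.mul_one]
    abel
  have c1 : ContinuousOn (fun t => (θ.1 - flowCov F θ t * (F.Cᵀ * θ.2.2.2 * F.C))
      * ((flowX F θ t)⁻¹)ᵀ) (Icc 0 F.T) := by
    refine ContinuousOn.mul ?_ fun t ht => (d1 t ht).continuousAt.continuousWithinAt
    exact continuousOn_const.sub ((h.continuousOn_flowCov.mono fun _ ht => ht.1).mul
      continuousOn_const)
  have h1 := IsPrimitiveOn.mulVec hT (isPrimitiveOn_entry hT d1 c1)
    (isPrimitiveOn_flowOutput F θ) i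
  refine h1.congr hT (fun t _ => rfl) fun s hs => ?_
  refine congrFun ?_ i
  have e1 : ((flowX F θ s)⁻¹)ᵀ * ((flowY F θ s)ᵀ * F.Cᵀ * θ.2.2.2)
      = flowCov F θ s * F.Cᵀ * θ.2.2.2 := by
    rw [← h.transpose_flowCov hs.1, flowCov, Matrix.transpose_mul]
    simp only [Matrix.mul_assoc]
  rw [Matrix.mulVec_mulVec, e1, ← Matrix.mulVec_mulVec, flowFilterDeriv]
  change _ = (θ.1 - flowCov F θ s * (F.Cᵀ * θ.2.2.2 * F.C)) *ᵥ flowFilter F θ s + _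
  simp only [Matrix.sub_mulVec, Matrix.mulVec_sub, Matrix.mulVec_mulVec, Matrix.mul_assoc]
  abel

theorem continuousOn_pi_of_isPrimitiveOn {d : ℕ} {T : ℝ} {f f' : ℝ → Fin d → ℝ}
    (h : ∀ i, IsPrimitiveOn T (fun s => f s i) (fun s => f' s i)) : ContinuousOn f (Icc 0 T) :=
  continuousOn_pi.2 fun i => (h i).continuousOn

theorem flowFilter_zero (F : Setup n m r) (θ : Coeffs n m r) : flowFilter F θ 0 = F.x₀ := by
  simp [flowFilter, flowOutput]

theorem integral_filter_congr {F : Setup n m r} {S : Sys n m r} (h : S.coeffs.Admissible)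
    (x : ℝ → Fin n → ℝ) {t : ℝ} (ht : t ∈ Icc 0 F.T) :
    ∫ s in (0 : ℝ)..t,
      (S.A *ᵥ x s + (errorCov F S s * F.Cᵀ * S.Q⁻¹) *ᵥ (F.y s - F.C *ᵥ x s))
    = ∫ s in (0 : ℝ)..t, flowFilterDeriv F S.coeffs x s := by
  refine intervalIntegral.integral_congr fun s hs => ?_
  rw [uIcc_of_le ht.1] at hs
  simp only [flowFilterDeriv, errorCov_eq h ⟨hs.1, hs.2.trans ht.2⟩]
  rfl

theorem isFilterSol_flowFilter {F : Setup n m r} {S : Sys n m r} (h : S.coeffs.Admissible) :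
    IsFilterSol F S (flowFilter F S.coeffs) where
  continuousOn := continuousOn_pi_of_isPrimitiveOn h.isPrimitiveOn_flowFilter
  integral_eq t ht := by
    rw [integral_filter_congr h _ ht,
      eq_integral_of_isPrimitiveOn h.isPrimitiveOn_flowFilter ht, flowFilter_zero]

/-- For any solution `x`, the product `Xᵀ x` has derivative `Yᵀ Cᵀ W y`, which does not involve `x`;
integrating determines `x`. -/
theorem IsFilterSol.eqOn_flowFilter {F : Setup n m r} {S : Sys n m r} (h : S.coeffs.Admissible)
    {x : ℝ → Fin n → ℝ} (hx : IsFilterSol F S x) :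
    EqOn x (flowFilter F S.coeffs) (Icc 0 F.T) := by
  have hT := F.T_pos.le
  set θ := S.coeffs with hθ
  have hx0 : x 0 = F.x₀ := by simpa using hx.integral_eq 0 ⟨le_rfl, hT⟩
  have cP : ContinuousOn (flowCov F θ) (Icc 0 F.T) := h.continuousOn_flowCov.mono fun _ ht => ht.1
  have hcx : ContinuousOn (fun s => F.C *ᵥ x s) (Icc 0 F.T) :=
    (Continuous.matrix_mulVec continuous_const continuous_id).comp_continuousOn hx.continuousOn
  have hax : ContinuousOn (fun s => θ.1 *ᵥ x s) (Icc 0 F.T) :=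
    (Continuous.matrix_mulVec continuous_const continuous_id).comp_continuousOn hx.continuousOn
  have hint : IntervalIntegrable (flowFilterDeriv F θ x) volume 0 F.T := by
    rw [← uIcc_of_le hT] at hcx hax
    refine hax.intervalIntegrable.add (intervalIntegrable_mulVec hT ?_
      (F.intervalIntegrable_y.sub hcx.intervalIntegrable))
    exact continuous_matrix_mul.comp_continuousOn ((continuous_matrix_mul.comp_continuousOn
      (cP.prodMk continuousOn_const)).prodMk continuousOn_const)
  have px := isPrimitiveOn_apply (f := x) hint (fun t ht => by
    rw [hx0, ← integral_filter_congr h x ht]; exact hx.integral_eq t ht)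
  have pX := isPrimitiveOn_entry hT
    (fun t _ => hasDerivAt_transpose (hasDerivAt_flowX F θ t)) (Continuous.continuousOn (by
      exact ((continuous_const.mul (continuous_flowX F θ)).add
        (continuous_const.mul (continuous_flowY F θ))).matrix_transpose))
  have pg := fun i => (IsPrimitiveOn.mulVec hT pX px i).congr hT
    (w := fun s => ((flowX F θ s)ᵀ *ᵥ x s) i)
    (w' := fun s => (((flowY F θ s)ᵀ * F.Cᵀ * θ.2.2.2) *ᵥ F.y s) i) (fun t _ => rfl) (by
      intro s hs
      refine congrFun ?_ i
      simp only [flowFilterDeriv, Matrix.mulVec_add, Matrix.mulVec_sub, Matrix.mulVec_mulVec,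
        ← Matrix.mul_assoc, h.transpose_flowX_mul_flowCov hs.1, Matrix.transpose_add,
        Matrix.transpose_mul, Matrix.transpose_neg, Matrix.transpose_transpose, Matrix.add_mulVec,
        h.transpose_W, Matrix.mul_neg, Matrix.neg_mulVec]
      abel)
  intro t ht
  have e1 := eq_integral_of_isPrimitiveOn pg ht
  simp only [flowX_zero, Matrix.transpose_one, Matrix.one_mulVec, hx0] at e1
  rw [flowFilter, flowOutput, ← e1, Matrix.mulVec_mulVec, ← Matrix.transpose_mul,
    h.flowX_mul_inv ht.1, Matrix.transpose_one, Matrix.one_mulVec]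

theorem isFilterSol_kalman {F : Setup n m r} {S : Sys n m r} (h : S.coeffs.Admissible) :
    IsFilterSol F S (kalman F S) :=
  Classical.epsilon_spec (p := IsFilterSol F S) ⟨_, isFilterSol_flowFilter h⟩

theorem kalman_eq {F : Setup n m r} {S : Sys n m r} (h : S.coeffs.Admissible) {t : ℝ}
    (ht : t ∈ Icc 0 F.T) : kalman F S t = flowFilter F S.coeffs t :=
  (isFilterSol_kalman h).eqOn_flowFilter h ht

theorem wellPosed {F : Setup n m r} {S : Sys n m r} (h : S.coeffs.Admissible) :
    WellPosed F S where
  riccati := isRiccatiSol_errorCov h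
  riccati_unique _ hP t ht := by rw [hP.eqOn_flowCov h ht, errorCov_eq h ht]
  posDef t ht := by rw [errorCov_eq h ht]; exact h.flowCov_posDef ht.1
  filter := isFilterSol_kalman h
  filter_unique _ hx t ht := by rw [hx.eqOn_flowFilter h ht, kalman_eq h ht]

/-! ### The value function -/

theorem sqNorm_zero {d : ℕ} (P : Matrix (Fin d) (Fin d) ℝ) : sqNorm P 0 = 0 := by simp [sqNorm]

theorem dotProduct_mulVec_comm {d : ℕ} {P : Matrix (Fin d) (Fin d) ℝ} (hP : Pᵀ = P)
    (u v : Fin d → ℝ) : u ⬝ᵥ (P *ᵥ v) = v ⬝ᵥ (P *ᵥ u) := by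
  rw [Matrix.dotProduct_mulVec, ← Matrix.mulVec_transpose, hP, dotProduct_comm]

theorem dotProduct_mulVec_transpose {d e : ℕ} (M : Matrix (Fin d) (Fin e) ℝ)
    (u : Fin d → ℝ) (v : Fin e → ℝ) : u ⬝ᵥ (M *ᵥ v) = (Mᵀ *ᵥ u) ⬝ᵥ v := by
  rw [Matrix.dotProduct_mulVec, Matrix.mulVec_transpose]

theorem sqNorm_sub {d : ℕ} {P : Matrix (Fin d) (Fin d) ℝ} (hP : Pᵀ = P) (u v : Fin d → ℝ) :
    sqNorm P (u - v) = sqNorm P u - 2 * (v ⬝ᵥ (P *ᵥ u)) + sqNorm P v := by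
  simp only [sqNorm, Matrix.mulVec_sub, sub_dotProduct, dotProduct_sub,
    dotProduct_mulVec_comm hP u v]
  ring

/-- Completion of the squares for the running cost. -/
theorem running_cost_eq {A P V : Matrix (Fin n) (Fin n) ℝ} {B : Matrix (Fin n) (Fin m) ℝ}
    {C : Matrix (Fin r) (Fin n) ℝ} {R : Matrix (Fin m) (Fin m) ℝ} {W : Matrix (Fin r) (Fin r) ℝ}
    (hP : Pᵀ = P) (hPV : P * V = 1) (hVP : V * P = 1) (hR : R.PosDef) (hW : Wᵀ = W)
    (x z : Fin n → ℝ) (v : Fin m → ℝ) (y : Fin r → ℝ) :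
    sqNorm R⁻¹ v + sqNorm W (y - C *ᵥ x)
      = ((A *ᵥ x + B *ᵥ v) - (A *ᵥ z + (V * Cᵀ * W) *ᵥ (y - C *ᵥ z))) ⬝ᵥ (P *ᵥ (x - z))
        + (x - z) ⬝ᵥ ((-(Aᵀ * P) - P * A + Cᵀ * W * C - P * (B * R * Bᵀ) * P) *ᵥ (x - z)
          + P *ᵥ ((A *ᵥ x + B *ᵥ v) - (A *ᵥ z + (V * Cᵀ * W) *ᵥ (y - C *ᵥ z))))
        + sqNorm W (y - C *ᵥ z) + sqNorm R⁻¹ (v - (R * Bᵀ * P) *ᵥ (x - z)) := by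
  have hRit : (R⁻¹)ᵀ = R⁻¹ := hR.inv.isHermitian
  have hRi : R⁻¹ * R = 1 :=
    Matrix.nonsing_inv_mul _ ((Matrix.isUnit_iff_isUnit_det _).1 hR.isUnit)
  -- Abbreviations: `e` is the deviation from the filter, `η` the innovation, `p = P e` the costate
  -- and `b = Bᵀ p`. The right-hand side is the derivative of `eᵀ P e` as the product rule produces
  -- it, plus two squares.
  obtain ⟨e, he⟩ : ∃ e, e = x - z := ⟨_, rfl⟩
  obtain ⟨η, hη⟩ : ∃ η, η = y - C *ᵥ z := ⟨_, rfl⟩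
  obtain ⟨p, hp⟩ : ∃ p, p = P *ᵥ e := ⟨_, rfl⟩
  obtain ⟨b, hb⟩ : ∃ b, b = Bᵀ *ᵥ p := ⟨_, rfl⟩
  have hVp : V *ᵥ p = e := by rw [hp, Matrix.mulVec_mulVec, hVP, Matrix.one_mulVec]
  have hVt : Vᵀ = V := by
    have h1 : Vᵀ * P = 1 := by
      have := congrArg Matrix.transpose hPV
      rwa [Matrix.transpose_mul, hP, Matrix.transpose_one] at this
    calc Vᵀ = Vᵀ * (P * V) := by rw [hPV, Matrix.mul_one]
      _ = V := by rw [← Matrix.mul_assoc, h1, Matrix.one_mul]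
  have e1 : y - C *ᵥ x = η - C *ᵥ e := by
    rw [hη, he, Matrix.mulVec_sub]; abel
  have e2 : (A *ᵥ x + B *ᵥ v) - (A *ᵥ z + (V * Cᵀ * W) *ᵥ η)
      = A *ᵥ e + B *ᵥ v - (V * Cᵀ * W) *ᵥ η := by
    rw [he, Matrix.mulVec_sub]; abel
  have e3 : (R * Bᵀ * P) *ᵥ e = R *ᵥ b := by
    rw [hb, hp]; simp only [Matrix.mulVec_mulVec, Matrix.mul_assoc]
  rw [← he, ← hη, e1, e2, e3, ← hp, sqNorm_sub hW, sqNorm_sub hRit, dotProduct_add,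
    dotProduct_mulVec_comm hP e, ← hp, dotProduct_comm _ p]
  have f1 : p ⬝ᵥ (B *ᵥ v) = b ⬝ᵥ v := by rw [hb, dotProduct_mulVec_transpose]
  have f2 : p ⬝ᵥ ((V * Cᵀ * W) *ᵥ η) = (C *ᵥ e) ⬝ᵥ (W *ᵥ η) := by
    rw [Matrix.mul_assoc, ← Matrix.mulVec_mulVec, dotProduct_mulVec_transpose, hVt, hVp,
      ← Matrix.mulVec_mulVec, dotProduct_mulVec_transpose, Matrix.transpose_transpose]
  have f3 : (R *ᵥ b) ⬝ᵥ (R⁻¹ *ᵥ v) = b ⬝ᵥ v := by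
    rw [dotProduct_mulVec_transpose, hRit, Matrix.mulVec_mulVec, hRi, Matrix.one_mulVec]
  have f4 : sqNorm R⁻¹ (R *ᵥ b) = b ⬝ᵥ (R *ᵥ b) := by
    rw [sqNorm, Matrix.mulVec_mulVec, hRi, Matrix.one_mulVec, dotProduct_comm]
  have f5 : e ⬝ᵥ ((-(Aᵀ * P) - P * A + Cᵀ * W * C - P * (B * R * Bᵀ) * P) *ᵥ e)
      = -(2 * (p ⬝ᵥ (A *ᵥ e))) + sqNorm W (C *ᵥ e) - b ⬝ᵥ (R *ᵥ b) := by
    have g1 : e ⬝ᵥ ((Aᵀ * P) *ᵥ e) = p ⬝ᵥ (A *ᵥ e) := by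
      rw [← Matrix.mulVec_mulVec, ← hp, dotProduct_mulVec_transpose, Matrix.transpose_transpose,
        dotProduct_comm]
    have g2 : e ⬝ᵥ ((P * A) *ᵥ e) = p ⬝ᵥ (A *ᵥ e) := by
      rw [← Matrix.mulVec_mulVec, dotProduct_mulVec_transpose, hP, ← hp]
    have g3 : e ⬝ᵥ ((Cᵀ * W * C) *ᵥ e) = sqNorm W (C *ᵥ e) := by
      rw [sqNorm, Matrix.mul_assoc, ← Matrix.mulVec_mulVec, ← Matrix.mulVec_mulVec,
        dotProduct_mulVec_transpose, Matrix.transpose_transpose]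
    have g4 : e ⬝ᵥ ((P * (B * R * Bᵀ) * P) *ᵥ e) = b ⬝ᵥ (R *ᵥ b) := by
      rw [← Matrix.mulVec_mulVec, ← hp, ← Matrix.mulVec_mulVec, dotProduct_mulVec_transpose, hP,
        ← hp, ← Matrix.mulVec_mulVec, ← Matrix.mulVec_mulVec, ← hb, dotProduct_mulVec_transpose,
        ← hb]
    simp only [Matrix.add_mulVec, Matrix.sub_mulVec, Matrix.neg_mulVec, dotProduct_add,
      dotProduct_sub, dotProduct_neg, g1, g2, g3, g4]
    ring
  rw [f3, f4, f5, dotProduct_sub, dotProduct_add, f1, f2]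
  ring

theorem integrable_sqNorm {d : ℕ} {μ : Measure ℝ} (P : Matrix (Fin d) (Fin d) ℝ)
    {f : ℝ → Fin d → ℝ} (hf : MemLp f 2 μ) : Integrable (fun s => sqNorm P (f s)) μ := by
  have hc : ∀ i, MemLp (fun s => f s i) 2 μ := fun i =>
    (ContinuousLinearMap.proj (R := ℝ) (φ := fun _ : Fin d => ℝ) i).comp_memLp' hf
  simp only [sqNorm, dotProduct, Matrix.mulVec]
  refine integrable_finsetSum _ fun i _ => (hc i).integrable_mul (q := 2) ?_
  exact memLp_finsetSum _ fun j _ => (hc j).const_mul _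

theorem memLp_of_continuousOn {d : ℕ} {f : ℝ → Fin d → ℝ} {t : ℝ}
    (hf : ContinuousOn f (Icc 0 t)) : MemLp f 2 (volume.restrict (Ioo 0 t)) := by
  obtain ⟨c, hc⟩ := isCompact_Icc.exists_bound_of_continuousOn hf
  refine MemLp.of_bound ((hf.mono Ioo_subset_Icc_self).aestronglyMeasurable measurableSet_Ioo) c ?_
  filter_upwards [ae_restrict_mem measurableSet_Ioo] with s hs using hc s ⟨hs.1.le, hs.2.le⟩

theorem memLp_mulVec {d e : ℕ} (M : Matrix (Fin d) (Fin e) ℝ) {f : ℝ → Fin e → ℝ}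
    {μ : Measure ℝ} (hf : MemLp f 2 μ) : MemLp (fun s => M *ᵥ f s) 2 μ :=
  (LinearMap.toContinuousLinearMap (Matrix.mulVecLin M)).comp_memLp' hf

theorem intervalIntegrable_sqNorm {d : ℕ} (P : Matrix (Fin d) (Fin d) ℝ) {t : ℝ} (ht : 0 ≤ t)
    {f : ℝ → Fin d → ℝ} (hf : MemLp f 2 (volume.restrict (Ioo 0 t))) :
    IntervalIntegrable (fun s => sqNorm P (f s)) volume 0 t := by
  rw [intervalIntegrable_iff_integrableOn_Ioo_of_le ht]
  exact integrable_sqNorm P hf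

theorem continuousOn_matrix_mulVec {d e : ℕ} {M : ℝ → Matrix (Fin d) (Fin e) ℝ}
    {f : ℝ → Fin e → ℝ} {s : Set ℝ} (hM : ContinuousOn M s) (hf : ContinuousOn f s) :
    ContinuousOn (fun t => M t *ᵥ f t) s :=
  (Continuous.matrix_mulVec (continuous_fst (X := Matrix (Fin d) (Fin e) ℝ))
    continuous_snd).comp_continuousOn (hM.prodMk hf)

/-- A system whose covariance matrices are positive definite. -/
structure Sys.IsRegular (S : Sys n m r) : Prop where
  posDef_Γ : S.Γ.PosDef
  posDef_R : S.R.PosDef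
  posDef_Q : S.Q.PosDef

theorem Sys.IsRegular.admissible {S : Sys n m r} (h : S.IsRegular) : S.coeffs.Admissible :=
  ⟨h.posDef_Γ, h.posDef_R.posSemidef, h.posDef_Q.inv.posSemidef⟩

/-- Integrating `running_cost_eq` turns the derivative of `eᵀ P e` into boundary terms. The one at
`0` cancels the initial cost, because `P(0) = Γ⁻¹` and the filter starts at `x₀`. -/
theorem cost_eq {F : Setup n m r} {S : Sys n m r} (h : S.IsRegular) {t : ℝ}
    (ht : t ∈ Icc 0 F.T) {ξ : Fin n → ℝ} {x : ℝ → Fin n → ℝ} {v : ℝ → Fin m → ℝ}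
    (hxv : IsAdmissible F S t ξ x v) :
    cost F S t x v = 1 / 2 * sqNorm (flowPrec F S.coeffs t) (ξ - flowFilter F S.coeffs t)
      + 1 / 2 * (∫ s in (0 : ℝ)..t, sqNorm S.Q⁻¹ (F.y s - F.C *ᵥ flowFilter F S.coeffs s))
      + 1 / 2 * ∫ s in (0 : ℝ)..t, sqNorm S.R⁻¹
        (v s - (S.R * F.Bᵀ * flowPrec F S.coeffs s) *ᵥ (x s - flowFilter F S.coeffs s)) := by
  have ha := h.admissible
  set θ := S.coeffs with hθ
  set z := flowFilter F θ with hz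
  set P := flowPrec F θ with hP
  have pz : ∀ i, IsPrimitiveOn t (fun s => z s i) (fun s => flowFilterDeriv F θ z s i) :=
    fun i => (ha.isPrimitiveOn_flowFilter i).mono ht
  have cz : ContinuousOn z (Icc 0 t) := continuousOn_pi_of_isPrimitiveOn pz
  have cP : ContinuousOn P (Icc 0 t) := ha.continuousOn_flowPrec.mono fun _ hs => hs.1
  have lv := hxv.memLp
  have ly : MemLp F.y 2 (volume.restrict (Ioo 0 t)) :=
    F.y_memLp.mono_measure (Measure.restrict_mono (Ioo_subset_Ioo_right ht.2) le_rfl)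
  have lz := memLp_of_continuousOn cz
  have iv : IntervalIntegrable v volume 0 t := by
    rw [intervalIntegrable_iff_integrableOn_Ioo_of_le ht.1]
    exact lv.integrable (by norm_num)
  have px := isPrimitiveOn_apply (f := x) (T := t)
    (f' := fun s => S.A *ᵥ x s + F.B *ᵥ v s) (by
      refine IntervalIntegrable.add ?_ (intervalIntegrable_mulVec ht.1 continuousOn_const iv)
      refine ContinuousOn.intervalIntegrable ?_
      rw [uIcc_of_le ht.1]
      exact continuousOn_matrix_mulVec continuousOn_const hxv.continuousOn) hxv.integral_eq
  have pe := fun i => (px i).sub (pz i)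
  have pP := isPrimitiveOn_entry ht.1 (fun s hs => ha.hasDerivAt_flowPrec (F := F) hs.1) (by
    exact ((((continuousOn_const.mul cP).neg).sub (cP.mul continuousOn_const)).add
      continuousOn_const).sub ((cP.mul continuousOn_const).mul cP))
  have pD := IsPrimitiveOn.dotProduct (x := fun s => x s - z s) ht.1 pe
    (IsPrimitiveOn.mulVec (x := fun s => x s - z s) ht.1 pP pe)
  have key := pD.eq_integral t ⟨ht.1, le_rfl⟩
  have i1 := pD.integrable
  have i2 : IntervalIntegrable (fun s => sqNorm S.Q⁻¹ (F.y s - F.C *ᵥ z s)) volume 0 t :=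
    intervalIntegrable_sqNorm _ ht.1 (ly.sub (memLp_mulVec _ lz))
  have i3 : IntervalIntegrable (fun s => sqNorm S.R⁻¹
      (v s - (S.R * F.Bᵀ * P s) *ᵥ (x s - z s))) volume 0 t := by
    refine intervalIntegrable_sqNorm _ ht.1 (lv.sub (memLp_of_continuousOn ?_))
    exact continuousOn_matrix_mulVec (continuous_matrix_mul.comp_continuousOn
      (continuousOn_const.prodMk cP)) (hxv.continuousOn.sub cz)
  have e0 : P 0 = S.Γ⁻¹ := by simp [hP, flowPrec, hθ, Sys.coeffs]
  have z0 : z 0 = F.x₀ := flowFilter_zero F θ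
  have hc : ∫ s in (0 : ℝ)..t, (sqNorm S.R⁻¹ (v s) + sqNorm S.Q⁻¹ (F.y s - F.C *ᵥ x s))
      = (sqNorm (P t) (x t - z t) - sqNorm (P 0) (x 0 - z 0))
        + (∫ s in (0 : ℝ)..t, sqNorm S.Q⁻¹ (F.y s - F.C *ᵥ z s))
        + ∫ s in (0 : ℝ)..t, sqNorm S.R⁻¹ (v s - (S.R * F.Bᵀ * P s) *ᵥ (x s - z s)) := by
    rw [sqNorm, sqNorm, sub_eq_of_eq_add' key, ← intervalIntegral.integral_add i1 i2,
      ← intervalIntegral.integral_add (i1.add i2) i3]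
    refine intervalIntegral.integral_congr fun s hs => ?_
    rw [uIcc_of_le ht.1] at hs
    exact running_cost_eq (A := S.A) (V := flowCov F θ s) (ha.transpose_flowPrec hs.1)
      (ha.flowPrec_mul_flowCov hs.1) (ha.flowCov_mul_flowPrec hs.1) h.posDef_R
      ha.transpose_W (x s) (z s) (v s) (F.y s)
  rw [cost, hc, e0, z0, hxv.final]
  ring

/-- The feedback makes the last integral in `cost_eq` vanish. The closed loop has generator `A + B R
Bᵀ P`, and `Y` is a fundamental matrix for it since `X = P Y`; so the state equation with prescribed
final value is solved by variation of constants, `x = Y g`. -/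
theorem exists_optimal {F : Setup n m r} {S : Sys n m r} (h : S.IsRegular) {t : ℝ}
    (ht : t ∈ Icc 0 F.T) (ξ : Fin n → ℝ) :
    ∃ x v, IsAdmissible F S t ξ x v ∧ ∀ s, v s
      = (S.R * F.Bᵀ * flowPrec F S.coeffs s) *ᵥ (x s - flowFilter F S.coeffs s) := by
  have ha := h.admissible
  set θ := S.coeffs with hθ
  set z := flowFilter F θ with hz
  set P := flowPrec F θ with hP
  set Y := flowY F θ with hY
  have cz : ContinuousOn z (Icc 0 t) := continuousOn_pi_of_isPrimitiveOn
    fun i => (ha.isPrimitiveOn_flowFilter i).mono ht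
  have cP : ContinuousOn P (Icc 0 t) := ha.continuousOn_flowPrec.mono fun _ hs => hs.1
  have cYi : ContinuousOn (fun s => (Y s)⁻¹) (Icc 0 t) := fun s hs =>
    (hasDerivAt_matrix_inv (hasDerivAt_flowY F θ s)
      (ha.isUnit_flowY hs.1)).continuousAt.continuousWithinAt
  set G := F.B * S.R * F.Bᵀ with hG
  set f : ℝ → Fin n → ℝ := fun s => ((Y s)⁻¹ * (G * P s)) *ᵥ z s with hf
  have cf : ContinuousOn f (Icc 0 t) :=
    continuousOn_matrix_mulVec (cYi.mul (continuousOn_const.mul cP)) cz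
  have iF : IntervalIntegrable f volume 0 t := by
    refine ContinuousOn.intervalIntegrable ?_
    rwa [uIcc_of_le ht.1]
  -- This initial value of `g` is chosen to give `g t = (Y t)⁻¹ *ᵥ ξ`, that is `x t = ξ`.
  set k : Fin n → ℝ := (Y t)⁻¹ *ᵥ ξ + ∫ s in (0 : ℝ)..t, f s with hk
  set g : ℝ → Fin n → ℝ := fun s => k - ∫ τ in (0 : ℝ)..s, f τ with hg
  have pg := isPrimitiveOn_apply (f := g) (f' := fun s => -f s) iF.neg (by
    intro s _
    simp [hg, intervalIntegral.integral_neg, sub_eq_add_neg])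
  have pY := isPrimitiveOn_entry ht.1 (fun s _ => hasDerivAt_flowY F θ s) 
    (((continuous_const.mul (continuous_flowX F θ)).add
      (continuous_const.mul (continuous_flowY F θ))).continuousOn)
  set x : ℝ → Fin n → ℝ := fun s => Y s *ᵥ g s with hx
  set v : ℝ → Fin m → ℝ := fun s => (S.R * F.Bᵀ * P s) *ᵥ (x s - z s) with hv
  have px := fun i => (IsPrimitiveOn.mulVec ht.1 pY pg i).congr ht.1
    (w := fun s => x s i) (w' := fun s => (S.A *ᵥ x s + F.B *ᵥ v s) i) (fun s _ => rfl) (by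
      intro s hs
      refine congrFun ?_ i
      have e1 : P s * Y s = flowX F θ s := ha.flowPrec_mul_flowY hs.1
      have e2 : ∀ M, Y s * ((Y s)⁻¹ * M) = M := fun M => by
        rw [← Matrix.mul_assoc, ha.flowY_mul_inv hs.1, Matrix.one_mul]
      change _ = (G * flowX F θ s + S.A * Y s) *ᵥ g s + Y s *ᵥ (-f s)
      simp only [hf, Matrix.mulVec_neg, Matrix.mulVec_mulVec, e2, ← e1, hv, hx, hG,
        Matrix.mulVec_sub, Matrix.add_mulVec, Matrix.mul_assoc]
      abel)
  have cx : ContinuousOn x (Icc 0 t) := continuousOn_pi_of_isPrimitiveOn px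
  refine ⟨x, v, ⟨memLp_of_continuousOn ?_, cx,
    fun s hs => eq_integral_of_isPrimitiveOn px hs, ?_⟩, fun s => rfl⟩
  · exact continuousOn_matrix_mulVec (continuous_matrix_mul.comp_continuousOn
      (continuousOn_const.prodMk cP)) (cx.sub cz)
  · simp only [hx, hg, hk, add_sub_cancel_right, Matrix.mulVec_mulVec]
    rw [ha.flowY_mul_inv ht.1, Matrix.one_mulVec]

theorem sqNorm_nonneg {d : ℕ} {P : Matrix (Fin d) (Fin d) ℝ} (hP : P.PosSemidef)
    (u : Fin d → ℝ) : 0 ≤ sqNorm P u := by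
  simpa [sqNorm] using hP.dotProduct_mulVec_nonneg u

/-- The value function is a quadratic function centred at the Kalman filter. -/
theorem valueFn_eq {F : Setup n m r} {S : Sys n m r} (h : S.IsRegular) {t : ℝ}
    (ht : t ∈ Icc 0 F.T) (ξ : Fin n → ℝ) :
    valueFn F S t ξ = 1 / 2 * sqNorm (flowPrec F S.coeffs t) (ξ - flowFilter F S.coeffs t)
      + 1 / 2 * ∫ s in (0 : ℝ)..t, sqNorm S.Q⁻¹ (F.y s - F.C *ᵥ flowFilter F S.coeffs s) := by
  rw [valueFn]
  split_ifs with h0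
  · subst h0
    simp [flowFilter_zero, flowPrec, Sys.coeffs]
  · refine IsLeast.csInf_eq ⟨?_, ?_⟩
    · obtain ⟨x, v, hxv, hv⟩ := exists_optimal h ht ξ
      refine ⟨x, v, hxv, ?_⟩
      rw [cost_eq h ht hxv]
      simp [hv, sqNorm_zero]
    · rintro J ⟨x, v, hxv, rfl⟩
      rw [cost_eq h ht hxv, le_add_iff_nonneg_right]
      refine mul_nonneg (by norm_num) (intervalIntegral.integral_nonneg ht.1 fun s _ => ?_)
      exact sqNorm_nonneg h.posDef_R.inv.posSemidef _

/-! ### Uniform bounds and Lipschitz estimates -/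

theorem abs_entry_le_norm {d e : ℕ} (M : Matrix (Fin d) (Fin e) ℝ) (i : Fin d) (j : Fin e) :
    |M i j| ≤ ‖M‖ := by
  have h := Matrix.l2_opNorm_mulVec M (EuclideanSpace.single j (1 : ℝ))
  simp only [PiLp.norm_single, norm_one, mul_one] at h
  have h2 := (PiLp.norm_apply_le (WithLp.toLp 2 (M *ᵥ (EuclideanSpace.single j (1 : ℝ)).ofLp)) i)
  refine le_trans (le_of_eq ?_) (h2.trans h)
  simp [Matrix.mulVec_single]

theorem abs_dotProduct_le {d : ℕ} (u v : Fin d → ℝ) : |u ⬝ᵥ v| ≤ d * (‖u‖ * ‖v‖) := by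
  calc |u ⬝ᵥ v| ≤ ∑ i, |u i * v i| := Finset.abs_sum_le_sum_abs _ _
    _ ≤ ∑ _i : Fin d, ‖u‖ * ‖v‖ := Finset.sum_le_sum fun i _ => by
        rw [abs_mul]
        exact mul_le_mul (norm_le_pi_norm u i) (norm_le_pi_norm v i) (abs_nonneg _)
          (norm_nonneg _)
    _ = d * (‖u‖ * ‖v‖) := by simp

/-- Vectors carry the sup norm and matrices the spectral norm, hence the harmless dimension factor.
-/
theorem norm_mulVec_le {d e : ℕ} (M : Matrix (Fin d) (Fin e) ℝ) (v : Fin e → ℝ) :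
    ‖M *ᵥ v‖ ≤ e * (‖M‖ * ‖v‖) := by
  refine (pi_norm_le_iff_of_nonneg (by positivity)).2 fun i => ?_
  refine (abs_dotProduct_le (M i) v).trans ?_
  gcongr
  exact (pi_norm_le_iff_of_nonneg (norm_nonneg _)).2 fun j => abs_entry_le_norm M i j

theorem isBoundedBilinearMap_matrix_mul {d e f : ℕ} :
    IsBoundedBilinearMap ℝ
      fun p : Matrix (Fin d) (Fin e) ℝ × Matrix (Fin e) (Fin f) ℝ => p.1 * p.2 where
  add_left _ _ _ := Matrix.add_mul _ _ _
  smul_left _ _ _ := Matrix.smul_mul _ _ _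
  add_right _ _ _ := Matrix.mul_add _ _ _
  smul_right _ _ _ := Matrix.mul_smul _ _ _
  bound := ⟨1, one_pos, fun M N => by rw [one_mul]; exact Matrix.l2_opNorm_mul M N⟩

/-- Uniformly bounded and uniformly nondegenerate coefficients. -/
def coeffSet (n m r : ℕ) (ρ : ℝ) : Set (Coeffs n m r) :=
  {θ | ‖θ‖ ≤ ρ ∧ θ.2.1ᵀ = θ.2.1 ∧ θ.2.2.1ᵀ = θ.2.2.1 ∧ θ.2.2.2ᵀ = θ.2.2.2 ∧
    ∀ (u : Fin n → ℝ) (v : Fin m → ℝ) (w : Fin r → ℝ),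
      u ⬝ᵥ u ≤ ρ * sqNorm θ.2.1 u ∧ 0 ≤ sqNorm θ.2.2.1 v ∧ 0 ≤ sqNorm θ.2.2.2 w}

theorem continuous_sqNorm {d : ℕ} :
    Continuous fun p : Matrix (Fin d) (Fin d) ℝ × (Fin d → ℝ) => sqNorm p.1 p.2 :=
  Continuous.dotProduct continuous_snd
    (Continuous.matrix_mulVec (continuous_fst (X := Matrix (Fin d) (Fin d) ℝ)) continuous_snd)

/-- All conditions are non-strict, hence closed: definiteness of `Γ` is encoded by `u ⬝ᵥ u ≤ ρ *
sqNorm Γ u`, while the other two covariances need only be semidefinite. -/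
theorem isCompact_coeffSet (ρ : ℝ) : IsCompact (coeffSet n m r ρ) := by
  have hq : ∀ {d : ℕ} (u : Fin d → ℝ), Continuous fun M : Matrix (Fin d) (Fin d) ℝ => sqNorm M u :=
    fun u => continuous_sqNorm.comp (continuous_id.prodMk continuous_const)
  have hΓ : Continuous fun θ : Coeffs n m r => θ.2.1 := by fun_prop
  have hR : Continuous fun θ : Coeffs n m r => θ.2.2.1 := by fun_prop
  have hW : Continuous fun θ : Coeffs n m r => θ.2.2.2 := by fun_prop
  refine Metric.isCompact_of_isClosed_isBounded ?_ ?_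
  · refine (isClosed_le continuous_norm continuous_const).inter
      ((isClosed_eq hΓ.matrix_transpose hΓ).inter ((isClosed_eq hR.matrix_transpose hR).inter
        ((isClosed_eq hW.matrix_transpose hW).inter ?_)))
    change IsClosed {θ : Coeffs n m r | ∀ (u : Fin n → ℝ) (v : Fin m → ℝ) (w : Fin r → ℝ),
      u ⬝ᵥ u ≤ ρ * sqNorm θ.2.1 u ∧ 0 ≤ sqNorm θ.2.2.1 v ∧ 0 ≤ sqNorm θ.2.2.2 w}
    simp only [ofPred_forall]
    refine isClosed_iInter fun u => isClosed_iInter fun v => isClosed_iInter fun w => ?_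
    exact (isClosed_le continuous_const (continuous_const.mul ((hq u).comp hΓ))).inter
      ((isClosed_le continuous_const ((hq v).comp hR)).inter
        (isClosed_le continuous_const ((hq w).comp hW)))
  · refine (Metric.isBounded_closedBall (x := (0 : Coeffs n m r)) (r := ρ)).subset fun θ hθ => ?_
    rw [mem_closedBall_zero_iff]
    exact hθ.1

theorem admissible_of_mem_coeffSet {ρ : ℝ} {θ : Coeffs n m r} (h : θ ∈ coeffSet n m r ρ) :
    θ.Admissible := by
  obtain ⟨h0, h1, h2, h3, h4⟩ := h
  refine ⟨Matrix.PosDef.of_dotProduct_mulVec_pos h1 fun u hu => ?_,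
    Matrix.PosSemidef.of_dotProduct_mulVec_nonneg h2 fun v => ?_,
    Matrix.PosSemidef.of_dotProduct_mulVec_nonneg h3 fun w => ?_⟩
  · have hp : 0 < u ⬝ᵥ u := by simpa using Matrix.dotProduct_star_self_pos_iff.2 hu
    exact pos_of_mul_pos_right (hp.trans_le (h4 u 0 0).1) ((norm_nonneg _).trans h0)
  · exact (h4 0 v 0).2.1
  · exact (h4 0 0 w).2.2

/-- A `C¹` function is locally Lipschitz, and on a compact set local Lipschitz continuity is global;
convexity of `K` is not needed. -/
theorem exists_bound_and_lipschitz {E G : Type*} [NormedAddCommGroup E] [NormedSpace ℝ E]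
    [NormedAddCommGroup G] [NormedSpace ℝ G] {s : Set ℝ} {K : Set E} (hs : IsCompact s)
    (hK : IsCompact K) {f : ℝ × E → G} (hf : ∀ p ∈ s ×ˢ K, ContDiffAt ℝ 1 f p) :
    ∃ L : ℝ, 0 ≤ L ∧ (∀ t ∈ s, ∀ θ ∈ K, ‖f (t, θ)‖ ≤ L) ∧
      ∀ t ∈ s, ∀ θ ∈ K, ∀ η ∈ K, ‖f (t, θ) - f (t, η)‖ ≤ L * ‖θ - η‖ := by
  have hc : ContinuousOn f (s ×ˢ K) := fun p hp => (hf p hp).continuousAt.continuousWithinAt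
  obtain ⟨L₁, hL₁⟩ := (hs.prod hK).exists_bound_of_continuousOn hc
  have hl : LocallyLipschitzOn (s ×ˢ K) f := fun p hp => by
    obtain ⟨L, t, ht, hL⟩ := (hf p hp).exists_lipschitzOnWith
    exact ⟨L, t, nhdsWithin_le_nhds ht, hL⟩
  obtain ⟨L₂, hL₂⟩ := hl.exists_lipschitzOnWith_of_compact (hs.prod hK)
  refine ⟨max L₁ L₂, le_max_of_le_right L₂.2, fun t ht θ hθ => (hL₁ _ ⟨ht, hθ⟩).trans
    (le_max_left _ _), fun t ht θ hθ η hη => ?_⟩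
  have h := hL₂.dist_le_mul (t, θ) ⟨ht, hθ⟩ (t, η) ⟨ht, hη⟩
  rw [dist_eq_norm, dist_eq_norm, Prod.mk_sub_mk, sub_self, Prod.norm_mk, norm_zero,
    max_eq_right (norm_nonneg _)] at h
  exact h.trans (mul_le_mul_of_nonneg_right (le_max_right _ _) (norm_nonneg _))

/-! ### Smooth dependence on time and coefficients -/

section Smooth

variable (F : Setup n m r)

theorem contDiff_exp_hamiltonian :
    ContDiff ℝ 1 fun p : ℝ × Coeffs n m r => NormedSpace.exp (p.1 • hamiltonian F p.2) := by
  have h1 : ContDiff ℝ 1 fun p : ℝ × Coeffs n m r => p.1 • hamiltonian F p.2 :=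
    contDiff_fst.smul ((contDiff_linearMap (hamiltonian F)).comp contDiff_snd)
  have h2 : ContDiff ℝ 1
      (NormedSpace.exp : Matrix (Fin n ⊕ Fin n) (Fin n ⊕ Fin n) ℝ → _) :=
    contDiff_iff_contDiffAt.2 fun x => (NormedSpace.exp_analytic (𝕂 := ℝ) x).contDiffAt
  exact h2.comp h1

theorem contDiff_flowX : ContDiff ℝ 1 fun p : ℝ × Coeffs n m r => flowX F p.2 p.1 :=
  ((contDiff_linearMap (blockMap Sum.inl Sum.inl)).comp (contDiff_exp_hamiltonian F)).add
    (((contDiff_linearMap (blockMap Sum.inl Sum.inr)).comp (contDiff_exp_hamiltonian F)).mul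
      (contDiff_fst.comp (contDiff_snd.comp contDiff_snd)))

theorem contDiff_flowY : ContDiff ℝ 1 fun p : ℝ × Coeffs n m r => flowY F p.2 p.1 :=
  ((contDiff_linearMap (blockMap Sum.inr Sum.inl)).comp (contDiff_exp_hamiltonian F)).add
    (((contDiff_linearMap (blockMap Sum.inr Sum.inr)).comp (contDiff_exp_hamiltonian F)).mul
      (contDiff_fst.comp (contDiff_snd.comp contDiff_snd)))

theorem contDiff_transpose {d e : ℕ} :
    ContDiff ℝ 1 fun M : Matrix (Fin d) (Fin e) ℝ => Mᵀ :=
  contDiff_linearMap (Matrix.transposeLinearEquiv (Fin d) (Fin e) ℝ ℝ).toLinearMap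

theorem contDiffAt_matrix_inv {d : ℕ} {M : Matrix (Fin d) (Fin d) ℝ} (hM : IsUnit M) :
    ContDiffAt ℝ 1 (fun N : Matrix (Fin d) (Fin d) ℝ => N⁻¹) M := by
  obtain ⟨U, rfl⟩ := hM
  have h := contDiffAt_ringInverse (n := 1) ℝ U
  have e : (fun N : Matrix (Fin d) (Fin d) ℝ => N⁻¹) = Ring.inverse := by
    ext1 N; exact Matrix.nonsing_inv_eq_ringInverse N
  rwa [e]

theorem contDiffAt_flowX_inv {θ : Coeffs n m r} (h : θ.Admissible) {t : ℝ} (ht : 0 ≤ t) :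
    ContDiffAt ℝ 1 (fun p : ℝ × Coeffs n m r => ((flowX F p.2 p.1)⁻¹)ᵀ) (t, θ) :=
  contDiff_transpose.contDiffAt.comp (t, θ)
    (ContDiffAt.comp (t, θ) (f := fun p : ℝ × Coeffs n m r => flowX F p.2 p.1)
      (contDiffAt_matrix_inv (h.isUnit_flowX ht)) (contDiff_flowX F).contDiffAt)

theorem contDiffAt_flowPrec {θ : Coeffs n m r} (h : θ.Admissible) {t : ℝ} (ht : 0 ≤ t) :
    ContDiffAt ℝ 1 (fun p : ℝ × Coeffs n m r => flowPrec F p.2 p.1) (t, θ) :=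
  (contDiff_flowX F).contDiffAt.mul
    (ContDiffAt.comp (t, θ) (f := fun p : ℝ × Coeffs n m r => flowY F p.2 p.1)
      (contDiffAt_matrix_inv (h.isUnit_flowY ht)) (contDiff_flowY F).contDiffAt)

theorem contDiff_outputWeight : ContDiff ℝ 1
    fun p : ℝ × Coeffs n m r => (flowY F p.2 p.1)ᵀ * F.Cᵀ * p.2.2.2.2 :=
  isBoundedBilinearMap_matrix_mul.contDiff.comp
    ((isBoundedBilinearMap_matrix_mul.contDiff.comp
      ((contDiff_transpose.comp (contDiff_flowY F)).prodMk contDiff_const)).prodMk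
        (contDiff_snd.comp (contDiff_snd.comp (contDiff_snd.comp contDiff_snd))))

end Smooth

theorem norm_integral_mulVec_y_le (F : Setup n m r) {M : ℝ → Matrix (Fin n) (Fin r) ℝ} {L t : ℝ}
    (hL : ∀ s ∈ Icc 0 F.T, ‖M s‖ ≤ L) (ht : t ∈ Icc 0 F.T) :
    ‖∫ s in (0 : ℝ)..t, M s *ᵥ F.y s‖ ≤ r * (L * ∫ s in (0 : ℝ)..F.T, ‖F.y s‖) := by
  have hy := F.intervalIntegrable_y.norm
  have hL0 : 0 ≤ L := (norm_nonneg _).trans (hL t ht)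
  have hsub : uIcc 0 t ⊆ uIcc 0 F.T := by
    rw [uIcc_of_le ht.1, uIcc_of_le F.T_pos.le]
    exact Icc_subset_Icc_right ht.2
  calc ‖∫ s in (0 : ℝ)..t, M s *ᵥ F.y s‖
      ≤ ∫ s in (0 : ℝ)..t, r * (L * ‖F.y s‖) := by
        refine intervalIntegral.norm_integral_le_of_norm_le ht.1 ?_
          (((hy.mono_set hsub).const_mul L).const_mul (r : ℝ))
        filter_upwards with s hs
        refine (norm_mulVec_le _ _).trans ?_
        have := hL s ⟨hs.1.le, hs.2.trans ht.2⟩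
        gcongr
    _ = r * (L * ∫ s in (0 : ℝ)..t, ‖F.y s‖) := by
        rw [intervalIntegral.integral_const_mul, intervalIntegral.integral_const_mul]
    _ ≤ r * (L * ∫ s in (0 : ℝ)..F.T, ‖F.y s‖) := by
        have := intervalIntegral.integral_mono_interval le_rfl ht.1 ht.2
          (Filter.Eventually.of_forall fun s => norm_nonneg (F.y s)) hy
        gcongr

/-- Since `y` is merely square integrable, compactness is applied to the two smooth factors `X⁻ᵀ`
and `Yᵀ Cᵀ W`; the output enters only through the integral of its norm. -/
theorem exists_lipschitz_flowFilter (F : Setup n m r) (ρ : ℝ) :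
    ∃ L : ℝ, 0 ≤ L ∧ ∀ t ∈ Icc 0 F.T, ∀ θ ∈ coeffSet n m r ρ, ∀ η ∈ coeffSet n m r ρ,
      ‖flowFilter F θ t - flowFilter F η t‖ ≤ L * ‖θ - η‖ := by
  obtain ⟨L₁, hL₁, hb₁, hl₁⟩ := exists_bound_and_lipschitz (isCompact_Icc (a := 0) (b := F.T))
    (isCompact_coeffSet (n := n) (m := m) (r := r) ρ)
    (f := fun p : ℝ × Coeffs n m r => ((flowX F p.2 p.1)⁻¹)ᵀ)
    (fun p hp => contDiffAt_flowX_inv F (admissible_of_mem_coeffSet hp.2) hp.1.1)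
  obtain ⟨L₂, hL₂, hb₂, hl₂⟩ := exists_bound_and_lipschitz (isCompact_Icc (a := 0) (b := F.T))
    (isCompact_coeffSet (n := n) (m := m) (r := r) ρ)
    (fun p _ => (contDiff_outputWeight F).contDiffAt (x := p))
  set N := ∫ s in (0 : ℝ)..F.T, ‖F.y s‖ with hN
  have hN0 : 0 ≤ N := intervalIntegral.integral_nonneg F.T_pos.le fun s _ => norm_nonneg _
  refine ⟨n * (L₁ * (‖F.x₀‖ + r * (L₂ * N))) + n * (L₁ * (r * (L₂ * N))), by positivity, ?_⟩
  intro t ht θ hθ η hη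
  have b1 : ‖flowOutput F θ t‖ ≤ ‖F.x₀‖ + r * (L₂ * N) :=
    (norm_add_le _ _).trans (by
      have := norm_integral_mulVec_y_le F (fun s hs => hb₂ s hs θ hθ) ht
      gcongr)
  have b2 : ‖flowOutput F θ t - flowOutput F η t‖ ≤ r * (L₂ * ‖θ - η‖ * N) := by
    have hsub : uIcc 0 t ⊆ uIcc 0 F.T := by
      rw [uIcc_of_le ht.1, uIcc_of_le F.T_pos.le]
      exact Icc_subset_Icc_right ht.2
    rw [flowOutput, flowOutput, add_sub_add_left_eq_sub, ← intervalIntegral.integral_sub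
      ((intervalIntegrable_flowOutput F θ).mono_set hsub)
      ((intervalIntegrable_flowOutput F η).mono_set hsub)]
    simp only [← Matrix.sub_mulVec]
    exact norm_integral_mulVec_y_le F (fun s hs => hl₂ s hs θ hθ η hη) ht
  have e : flowFilter F θ t - flowFilter F η t
      = (((flowX F θ t)⁻¹)ᵀ - ((flowX F η t)⁻¹)ᵀ) *ᵥ flowOutput F θ t
        + ((flowX F η t)⁻¹)ᵀ *ᵥ (flowOutput F θ t - flowOutput F η t) := by
    rw [flowFilter, flowFilter, Matrix.sub_mulVec, Matrix.mulVec_sub]; abel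
  have c1 := hl₁ t ht θ hθ η hη
  have c2 := hb₁ t ht η hη
  rw [e]
  calc _ ≤ _ := norm_add_le _ _
    _ ≤ n * (‖((flowX F θ t)⁻¹)ᵀ - ((flowX F η t)⁻¹)ᵀ‖ * ‖flowOutput F θ t‖)
        + n * (‖((flowX F η t)⁻¹)ᵀ‖ * ‖flowOutput F θ t - flowOutput F η t‖) :=
      add_le_add (norm_mulVec_le _ _) (norm_mulVec_le _ _)
    _ ≤ n * ((L₁ * ‖θ - η‖) * (‖F.x₀‖ + r * (L₂ * N)))
        + n * (L₁ * (r * (L₂ * ‖θ - η‖ * N))) := by gcongr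
    _ = _ := by ring

theorem exists_bound_flowPrec (F : Setup n m r) (ρ : ℝ) :
    ∃ L : ℝ, 0 ≤ L ∧ ∀ t ∈ Icc 0 F.T, ∀ θ ∈ coeffSet n m r ρ, ∀ u v : Fin n → ℝ,
      |u ⬝ᵥ (flowPrec F θ t *ᵥ v)| ≤ L * (‖u‖ * ‖v‖) := by
  obtain ⟨L₁, hL₁, hb₁, -⟩ := exists_bound_and_lipschitz (isCompact_Icc (a := 0) (b := F.T))
    (isCompact_coeffSet (n := n) (m := m) (r := r) ρ)
    (f := fun p : ℝ × Coeffs n m r => flowPrec F p.2 p.1)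
    (fun p hp => contDiffAt_flowPrec F (admissible_of_mem_coeffSet hp.2) hp.1.1)
  refine ⟨n * (n * L₁), by positivity, fun t ht θ hθ u v => ?_⟩
  have c1 := hb₁ t ht θ hθ
  calc _ ≤ n * (‖u‖ * ‖flowPrec F θ t *ᵥ v‖) := abs_dotProduct_le _ _
    _ ≤ n * (‖u‖ * (n * (‖flowPrec F θ t‖ * ‖v‖))) := by gcongr; exact norm_mulVec_le _ _
    _ ≤ n * (‖u‖ * (n * (L₁ * ‖v‖))) := by gcongr
    _ = _ := by ring

theorem sqNorm_pos {d : ℕ} {P : Matrix (Fin d) (Fin d) ℝ} (hP : P.PosDef)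
    {u : Fin d → ℝ} (hu : u ≠ 0) : 0 < sqNorm P u := by
  simpa [sqNorm] using hP.dotProduct_mulVec_pos hu

theorem sqNorm_smul {d : ℕ} (P : Matrix (Fin d) (Fin d) ℝ) (c : ℝ) (u : Fin d → ℝ) :
    sqNorm P (c • u) = c ^ 2 * sqNorm P u := by
  simp only [sqNorm, Matrix.mulVec_smul, dotProduct_smul, smul_dotProduct, smul_eq_mul]
  ring

/-- The precision matrices are uniformly coercive. -/
theorem exists_coercive_flowPrec (F : Setup n m r) (ρ : ℝ) :
    ∃ L : ℝ, 0 ≤ L ∧ ∀ t ∈ Icc 0 F.T, ∀ θ ∈ coeffSet n m r ρ, ∀ u : Fin n → ℝ,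
      ‖u‖ ^ 2 ≤ L * sqNorm (flowPrec F θ t) u := by
  have hK := ((isCompact_Icc (a := 0) (b := F.T)).prod
    (isCompact_coeffSet (n := n) (m := m) (r := r) ρ)).prod
    (isCompact_sphere (0 : Fin n → ℝ) 1)
  have hne : ∀ u ∈ Metric.sphere (0 : Fin n → ℝ) 1, u ≠ 0 := fun u hu h0 => by
    simp [h0] at hu
  -- The reciprocal of the quadratic form is bounded on the compact product with the unit sphere;
  -- homogeneity then extends the bound to all vectors.
  have hc : ContinuousOn
      (fun p : (ℝ × Coeffs n m r) × (Fin n → ℝ) => (sqNorm (flowPrec F p.1.2 p.1.1) p.2)⁻¹)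
      ((Icc 0 F.T ×ˢ coeffSet n m r ρ) ×ˢ Metric.sphere (0 : Fin n → ℝ) 1) := by
    refine ContinuousOn.inv₀ ?_ fun p hp => (sqNorm_pos
      ((admissible_of_mem_coeffSet hp.1.2).flowPrec_posDef hp.1.1.1) (hne _ hp.2)).ne'
    refine continuous_sqNorm.comp_continuousOn (ContinuousOn.prodMk ?_ continuousOn_snd)
    have h1 : ContinuousOn (fun p : ℝ × Coeffs n m r => flowPrec F p.2 p.1)
        (Icc 0 F.T ×ˢ coeffSet n m r ρ) := fun p hp =>
      (contDiffAt_flowPrec F (admissible_of_mem_coeffSet hp.2)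
        hp.1.1).continuousAt.continuousWithinAt
    exact h1.comp continuousOn_fst fun p hp => hp.1
  obtain ⟨L, hL⟩ := hK.exists_bound_of_continuousOn hc
  -- The bound may be negative if the compact set is empty, for example when `n = 0`.
  refine ⟨max L 0, le_max_right _ _, fun t ht θ hθ u => ?_⟩
  rcases eq_or_ne u 0 with rfl | hu
  · simp [sqNorm_zero]
  have hn : 0 < ‖u‖ := norm_pos_iff.2 hu
  have hmem : ‖u‖⁻¹ • u ∈ Metric.sphere (0 : Fin n → ℝ) 1 := by
    simp [norm_smul, hn.ne']
  have hpos := sqNorm_pos ((admissible_of_mem_coeffSet hθ).flowPrec_posDef (F := F) ht.1) hu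
  have h1 := hL ((t, θ), ‖u‖⁻¹ • u) ⟨⟨ht, hθ⟩, hmem⟩
  simp only [sqNorm_smul] at h1
  have h2 := (le_abs_self _).trans (h1.trans (le_max_left L 0))
  rw [mul_inv, inv_pow, inv_inv, ← div_eq_mul_inv, div_le_iff₀ hpos] at h2
  exact h2

/-! ### Expectations -/

section Mean

variable {ι V : Type*} [Fintype ι]

theorem mean_add [AddCommGroup V] [Module ℝ V] (f g : ι → V) :
    mean (fun i => f i + g i) = mean f + mean g := by
  simp [mean, Finset.sum_add_distrib]

theorem mean_sub_const [Nonempty ι] [AddCommGroup V] [Module ℝ V] (f : ι → V) (c : V) :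
    mean f - c = mean fun i => f i - c := by
  have h : (Fintype.card ι : ℝ) ≠ 0 := Nat.cast_ne_zero.2 Fintype.card_ne_zero
  simp only [mean, Finset.sum_sub_distrib, smul_sub, Finset.sum_const, Finset.card_univ]
  rw [← Nat.cast_smul_eq_nsmul ℝ, smul_smul, inv_mul_cancel₀ h, one_smul]

theorem mean_le_mean {f g : ι → ℝ} (h : ∀ i, f i ≤ g i) : mean f ≤ mean g := by
  simp only [mean, smul_eq_mul]
  have := Finset.sum_le_sum fun i (_ : i ∈ Finset.univ) => h i
  gcongr

theorem mean_const_mul (c : ℝ) (f : ι → ℝ) : mean (fun i => c * f i) = c * mean f := by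
  simp only [mean, smul_eq_mul, ← Finset.mul_sum]
  ring

theorem mean_nonneg {f : ι → ℝ} (h : ∀ i, 0 ≤ f i) : 0 ≤ mean f :=
  mul_nonneg (by positivity) (Finset.sum_nonneg fun i _ => h i)

theorem mean_const [Nonempty ι] (c : ℝ) : mean (fun _ : ι => c) = c := by
  have h : (Fintype.card ι : ℝ) ≠ 0 := Nat.cast_ne_zero.2 Fintype.card_ne_zero
  simp [mean, h]

theorem norm_mean_le [NormedAddCommGroup V] [NormedSpace ℝ V] (f : ι → V) :
    ‖mean f‖ ≤ mean fun i => ‖f i‖ := by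
  simp only [mean, norm_smul, norm_inv, Real.norm_natCast, smul_eq_mul]
  gcongr
  exact norm_sum_le _ _

theorem sqNorm_mean {d : ℕ} (M : ι → Matrix (Fin d) (Fin d) ℝ) (u : Fin d → ℝ) :
    sqNorm (mean M) u = mean fun i => sqNorm (M i) u := by
  simp only [sqNorm, mean, Matrix.smul_mulVec, dotProduct_smul, Matrix.sum_mulVec,
    dotProduct_sum]

theorem posDef_mean [Nonempty ι] {d : ℕ} {M : ι → Matrix (Fin d) (Fin d) ℝ}
    (h : ∀ i, (M i).PosDef) : (mean M).PosDef := by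
  refine Matrix.PosDef.smul ?_ (by positivity)
  exact Matrix.posDef_sum Finset.univ_nonempty fun i _ => h i

end Mean

/-! ### Bounds for inverse matrices -/

theorem dotProduct_le_norm_mul_norm {d : ℕ} (u v : Fin d → ℝ) :
    u ⬝ᵥ v ≤ ‖WithLp.toLp 2 u‖ * ‖WithLp.toLp 2 v‖ := by
  have h := real_inner_le_norm (WithLp.toLp 2 v : EuclideanSpace ℝ (Fin d)) (WithLp.toLp 2 u)
  rw [EuclideanSpace.inner_toLp_toLp] at h
  rw [mul_comm]
  simpa using h

theorem dotProduct_self_eq_norm_sq {d : ℕ} (u : Fin d → ℝ) :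
    u ⬝ᵥ u = ‖WithLp.toLp 2 u‖ ^ 2 := by
  rw [← real_inner_self_eq_norm_sq, EuclideanSpace.inner_toLp_toLp]
  simp

theorem sqNorm_le_norm_mul {d : ℕ} (M : Matrix (Fin d) (Fin d) ℝ) (u : Fin d → ℝ) :
    sqNorm M u ≤ ‖M‖ * (u ⬝ᵥ u) := by
  have h1 := Matrix.l2_opNorm_mulVec M (WithLp.toLp 2 u)
  have h2 := dotProduct_le_norm_mul_norm u (M *ᵥ u)
  rw [dotProduct_self_eq_norm_sq]
  calc sqNorm M u ≤ _ := h2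
    _ ≤ ‖WithLp.toLp 2 u‖ * (‖M‖ * ‖WithLp.toLp 2 u‖) := by gcongr; exact h1
    _ = _ := by ring

/-- Expand `0 ≤ sqNorm M (ρ u - M⁻¹ u)` and use `uᵀ M⁻¹ u ≤ ρ uᵀ u`. Together with the converse
below, this trades a bound on the inverse for an inequality linear in `M`, which passes to averages.
-/
theorem dotProduct_self_le_of_norm_inv_le {d : ℕ} {M : Matrix (Fin d) (Fin d) ℝ} (hM : M.PosDef)
    {ρ : ℝ} (h : ‖M⁻¹‖ ≤ ρ) (u : Fin d → ℝ) : u ⬝ᵥ u ≤ ρ * sqNorm M u := by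
  have hu := (Matrix.isUnit_iff_isUnit_det _).1 hM.isUnit
  -- If `ρ = 0`, then `M⁻¹ = 0` although `M` is invertible, so every vector is zero.
  rcases ((norm_nonneg _).trans h).eq_or_lt with h0 | h0
  · have h1 : M⁻¹ = 0 := by rw [← norm_le_zero_iff, h0]; exact h
    have h2 : u = 0 := by
      rw [← Matrix.one_mulVec u, ← Matrix.mul_nonsing_inv _ hu, h1]; simp
    simp [h2, sqNorm_zero]
  · have h1 := sqNorm_nonneg hM.posSemidef (ρ • u - M⁻¹ *ᵥ u)
    have hMt : Mᵀ = M := hM.isHermitian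
    rw [sqNorm_sub hMt, sqNorm_smul, Matrix.mulVec_smul, dotProduct_smul,
      dotProduct_mulVec_comm hMt, Matrix.mulVec_mulVec, Matrix.mul_nonsing_inv _ hu,
      Matrix.one_mulVec] at h1
    have h2 : sqNorm M (M⁻¹ *ᵥ u) ≤ ρ * (u ⬝ᵥ u) := by
      have : sqNorm M (M⁻¹ *ᵥ u) = sqNorm M⁻¹ u := by
        rw [sqNorm, Matrix.mulVec_mulVec, Matrix.mul_nonsing_inv _ hu, Matrix.one_mulVec,
          dotProduct_comm, sqNorm]
      rw [this]
      refine (sqNorm_le_norm_mul _ _).trans (mul_le_mul_of_nonneg_right h ?_)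
      rw [dotProduct_self_eq_norm_sq]; positivity
    rw [smul_eq_mul] at h1
    have h3 : 0 ≤ ρ * (ρ * sqNorm M u - u ⬝ᵥ u) := by nlinarith
    have := (mul_nonneg_iff_of_pos_left h0).1 h3
    linarith

theorem norm_inv_le_of_dotProduct_self_le {d : ℕ} {M : Matrix (Fin d) (Fin d) ℝ} (hM : M.PosDef)
    {ρ : ℝ} (hρ : 0 ≤ ρ) (h : ∀ u, u ⬝ᵥ u ≤ ρ * sqNorm M u) : ‖M⁻¹‖ ≤ ρ := by
  have hu := (Matrix.isUnit_iff_isUnit_det _).1 hM.isUnit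
  rw [Matrix.cstar_norm_def]
  refine ContinuousLinearMap.opNorm_le_bound _ hρ fun x => ?_
  have e : Matrix.toEuclideanCLM (n := Fin d) (𝕜 := ℝ) M⁻¹ x
      = WithLp.toLp 2 (M⁻¹ *ᵥ x.ofLp) := rfl
  rw [e]
  have h1 := h (M⁻¹ *ᵥ x.ofLp)
  rw [sqNorm, Matrix.mulVec_mulVec, Matrix.mul_nonsing_inv _ hu, Matrix.one_mulVec,
    dotProduct_self_eq_norm_sq] at h1
  have h2 := dotProduct_le_norm_mul_norm (M⁻¹ *ᵥ x.ofLp) x.ofLp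
  have h3 : ‖WithLp.toLp 2 (M⁻¹ *ᵥ x.ofLp)‖ * ‖WithLp.toLp 2 (M⁻¹ *ᵥ x.ofLp)‖
      ≤ ‖WithLp.toLp 2 (M⁻¹ *ᵥ x.ofLp)‖ * (ρ * ‖x‖) := by
    rw [← sq]
    refine h1.trans ((mul_le_mul_of_nonneg_left h2 hρ).trans (le_of_eq ?_))
    rw [WithLp.toLp_ofLp]; ring
  rcases (norm_nonneg (WithLp.toLp 2 (M⁻¹ *ᵥ x.ofLp))).eq_or_lt with h0 | h0
  · rw [← h0]; positivity
  · exact le_of_mul_le_mul_left h3 h0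

theorem norm_inv_sub_inv_le {d : ℕ} {M N : Matrix (Fin d) (Fin d) ℝ} (hM : M.PosDef)
    (hN : N.PosDef) {ρ : ℝ} (h1 : ‖M⁻¹‖ ≤ ρ) (h2 : ‖N⁻¹‖ ≤ ρ) :
    ‖M⁻¹ - N⁻¹‖ ≤ ρ ^ 2 * ‖M - N‖ := by
  have uM := (Matrix.isUnit_iff_isUnit_det _).1 hM.isUnit
  have uN := (Matrix.isUnit_iff_isUnit_det _).1 hN.isUnit
  have e : M⁻¹ - N⁻¹ = -(M⁻¹ * (M - N) * N⁻¹) := by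
    rw [Matrix.mul_sub, Matrix.sub_mul, Matrix.nonsing_inv_mul _ uM, Matrix.mul_assoc,
      Matrix.mul_nonsing_inv _ uN, Matrix.one_mul, Matrix.mul_one, neg_sub]
  have h0 := (norm_nonneg _).trans h1
  rw [e, norm_neg]
  calc _ ≤ ‖M⁻¹‖ * ‖M - N‖ * ‖N⁻¹‖ :=
        (norm_mul_le _ _).trans (mul_le_mul_of_nonneg_right (norm_mul_le _ _) (norm_nonneg _))
    _ ≤ ρ * ‖M - N‖ * ρ := by gcongr
    _ = _ := by ring

/-! ### Minimizing an average of quadratic functions -/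

/-- The minimizer is the precision-weighted average of the centres. The expansion of a quadratic
about it is exact, and its linear term vanishes by the optimality condition. -/
theorem exists_minimizer_mean_sqNorm {ι : Type*} [Fintype ι] [Nonempty ι] {d : ℕ}
    {P : ι → Matrix (Fin d) (Fin d) ℝ} (hP : ∀ i, (P i).PosDef) (z : ι → Fin d → ℝ)
    (c : ι → ℝ) :
    ∃ ξ : Fin d → ℝ, (mean fun i => P i *ᵥ (ξ - z i)) = 0 ∧
      ∀ ζ, (mean fun i => 1 / 2 * sqNorm (P i) (ζ - z i) + c i)
        = (mean fun i => 1 / 2 * sqNorm (P i) (ξ - z i) + c i)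
          + 1 / 2 * sqNorm (mean P) (ζ - ξ) := by
  have hPm := posDef_mean hP
  have hu := (Matrix.isUnit_iff_isUnit_det _).1 hPm.isUnit
  set ξ := (mean P)⁻¹ *ᵥ (mean fun i => P i *ᵥ z i) with hξ
  have h0 : (mean fun i => P i *ᵥ (ξ - z i)) = 0 := by
    have h1 : mean P *ᵥ ξ = mean fun i => P i *ᵥ z i := by
      rw [hξ, Matrix.mulVec_mulVec, Matrix.mul_nonsing_inv _ hu, Matrix.one_mulVec]
    have h2 : mean P *ᵥ ξ = mean fun i => P i *ᵥ ξ := by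
      simp only [mean, Matrix.smul_mulVec, Matrix.sum_mulVec]
    have h3 : (mean fun i => P i *ᵥ ξ)
        = (mean fun i => P i *ᵥ (ξ - z i)) + mean fun i => P i *ᵥ z i := by
      rw [← mean_add]; simp [Matrix.mulVec_sub]
    rw [← h2, h1] at h3
    simpa using h3
  refine ⟨ξ, h0, fun ζ => ?_⟩
  have h1 : ∀ i, 1 / 2 * sqNorm (P i) (ζ - z i) + c i
      = (1 / 2 * sqNorm (P i) (ξ - z i) + c i)
        + ((ζ - ξ) ⬝ᵥ (P i *ᵥ (ξ - z i)) + 1 / 2 * sqNorm (P i) (ζ - ξ)) := by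
    intro i
    have e : ζ - z i = (ξ - z i) - (ξ - ζ) := by abel
    have e2 : ζ - ξ = -(ξ - ζ) := by abel
    have hPt : (P i)ᵀ = P i := (hP i).isHermitian
    rw [e, sqNorm_sub hPt, e2, neg_dotProduct]
    simp only [sqNorm, Matrix.mulVec_neg, dotProduct_neg, neg_dotProduct, neg_neg]
    ring
  have h2 : (mean fun i => (ζ - ξ) ⬝ᵥ (P i *ᵥ (ξ - z i))) = 0 := by
    have : (mean fun i => (ζ - ξ) ⬝ᵥ (P i *ᵥ (ξ - z i)))
        = (ζ - ξ) ⬝ᵥ mean fun i => P i *ᵥ (ξ - z i) := by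
      simp only [mean, dotProduct_smul, dotProduct_sum]
    rw [this, h0, dotProduct_zero]
  simp only [h1]
  rw [mean_add, mean_add (fun i => (ζ - ξ) ⬝ᵥ (P i *ᵥ (ξ - z i))), h2, zero_add,
    mean_const_mul, ← sqNorm_mean]

/-- With `w = ξ - z j`, the optimality condition gives `mean (P i w) = mean (P i (z i - z j))`. Pair
with `w`, use coercivity on the left and boundedness on the right, and divide by `‖w‖`. -/
theorem norm_minimizer_sub_le {ι : Type*} [Fintype ι] [Nonempty ι] {d : ℕ}
    {P : ι → Matrix (Fin d) (Fin d) ℝ} {z : ι → Fin d → ℝ} {ξ : Fin d → ℝ}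
    (hξ : (mean fun i => P i *ᵥ (ξ - z i)) = 0) {a b : ℝ} (ha : 0 ≤ a) (hb : 0 ≤ b)
    (hPa : ∀ i u v, |u ⬝ᵥ (P i *ᵥ v)| ≤ a * (‖u‖ * ‖v‖))
    (hPb : ∀ i u, ‖u‖ ^ 2 ≤ b * sqNorm (P i) u) (j : ι) :
    ‖ξ - z j‖ ≤ b * a * mean fun i => ‖z i - z j‖ := by
  have hm : 0 ≤ mean fun i => ‖z i - z j‖ := mean_nonneg fun i => norm_nonneg _
  set w := ξ - z j with hw
  have h1 : (mean fun i => sqNorm (P i) w) = mean fun i => w ⬝ᵥ (P i *ᵥ (z i - z j)) := by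
    have e : ∀ i, sqNorm (P i) w = w ⬝ᵥ (P i *ᵥ (ξ - z i)) + w ⬝ᵥ (P i *ᵥ (z i - z j)) := by
      intro i
      rw [← dotProduct_add, ← Matrix.mulVec_add, sub_add_sub_cancel, sqNorm]
    have e2 : (mean fun i => w ⬝ᵥ (P i *ᵥ (ξ - z i))) = w ⬝ᵥ mean fun i => P i *ᵥ (ξ - z i) := by
      simp only [mean, dotProduct_smul, dotProduct_sum]
    simp only [e]
    rw [mean_add, e2, hξ, dotProduct_zero, zero_add]
  have h2 : ‖w‖ ^ 2 ≤ b * (a * (‖w‖ * mean fun i => ‖z i - z j‖)) := by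
    calc ‖w‖ ^ 2 = mean fun _ : ι => ‖w‖ ^ 2 := (mean_const _).symm
      _ ≤ mean fun i => b * sqNorm (P i) w := mean_le_mean fun i => hPb i w
      _ = b * mean fun i => w ⬝ᵥ (P i *ᵥ (z i - z j)) := by rw [mean_const_mul, h1]
      _ ≤ b * mean fun i => a * (‖w‖ * ‖z i - z j‖) :=
          mul_le_mul_of_nonneg_left
            (mean_le_mean fun i => (le_abs_self _).trans (hPa i _ _)) hb
      _ = _ := by rw [mean_const_mul, mean_const_mul]
  rcases (norm_nonneg w).eq_or_lt with h0 | h0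
  · rw [← h0]; positivity
  · refine le_of_mul_le_mul_left ?_ h0
    rw [← sq]
    exact h2.trans (le_of_eq (by ring))

/-! ### Uncertain systems -/

namespace Uncertainty

variable {U : Uncertainty n m r} {F : Setup n m r} {ρ : ℝ}

instance : Nonempty U.Param :=
  have := U.parA_nonempty.to_subtype
  have := U.parΓ_nonempty.to_subtype
  have := U.parR_nonempty.to_subtype
  have := U.parQ_nonempty.to_subtype
  inferInstance

theorem isRegular_sys (σ : U.Param) : (U.sys σ).IsRegular :=
  ⟨U.γ_posDef _ σ.2.1.2, U.r'_posDef _ σ.2.2.1.2, U.q_posDef _ σ.2.2.2.2⟩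

theorem isRegular_meanSys : U.meanSys.IsRegular :=
  ⟨posDef_mean fun σ => (isRegular_sys σ).posDef_Γ, posDef_mean fun σ => (isRegular_sys σ).posDef_R,
    posDef_mean fun σ => (isRegular_sys σ).posDef_Q⟩

end Uncertainty

theorem Sys.IsRegular.coeffs_mem {S : Sys n m r} (h : S.IsRegular) {ρ : ℝ} (hA : ‖S.A‖ ≤ ρ)
    (hΓ : ‖S.Γ‖ ≤ ρ) (hR : ‖S.R‖ ≤ ρ) (hQ : ‖S.Q⁻¹‖ ≤ ρ)
    (hΓ' : ∀ u, u ⬝ᵥ u ≤ ρ * sqNorm S.Γ u) : S.coeffs ∈ coeffSet n m r ρ :=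
  ⟨max_le hA (max_le hΓ (max_le hR hQ)), h.admissible.transpose_Γ, h.admissible.transpose_R,
    h.admissible.transpose_W, fun u v w => ⟨hΓ' u, sqNorm_nonneg h.posDef_R.posSemidef v,
      sqNorm_nonneg h.posDef_Q.inv.posSemidef w⟩⟩

/-- Only `Q` enters through its inverse, which costs the factor `ρ ^ 2`; no bound on `Q` itself is
required. -/
theorem Sys.IsRegular.norm_coeffs_sub_le {S S' : Sys n m r} (h : S.IsRegular) (h' : S'.IsRegular)
    {ρ : ℝ} (hQ : ‖S.Q⁻¹‖ ≤ ρ) (hQ' : ‖S'.Q⁻¹‖ ≤ ρ) :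
    ‖S.coeffs - S'.coeffs‖ ≤ (1 + ρ ^ 2) * (S - S').norm1 := by
  have h1 := norm_inv_sub_inv_le h.posDef_Q h'.posDef_Q hQ hQ'
  have a1 := norm_nonneg (S.A - S'.A)
  have a2 := norm_nonneg (S.Γ - S'.Γ)
  have a3 := norm_nonneg (S.R - S'.R)
  have a4 := norm_nonneg (S.Q - S'.Q)
  have e : (S - S').norm1 = ‖S.A - S'.A‖ + ‖S.Γ - S'.Γ‖ + ‖S.R - S'.R‖ + ‖S.Q - S'.Q‖ := rfl
  have hρ := sq_nonneg ρ
  have key : ∀ a, a ≤ (S - S').norm1 → a ≤ (1 + ρ ^ 2) * (S - S').norm1 := fun a ha => by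
    have h0 : 0 ≤ (S - S').norm1 := by rw [e]; positivity
    nlinarith [mul_nonneg hρ h0]
  refine max_le (key _ ?_) (max_le (key _ ?_) (max_le (key _ ?_) (h1.trans ?_)))
  · change ‖S.A - S'.A‖ ≤ _; linarith
  · change ‖S.Γ - S'.Γ‖ ≤ _; linarith
  · change ‖S.R - S'.R‖ ≤ _; linarith
  · have : ‖S.Q - S'.Q‖ ≤ (S - S').norm1 := by linarith
    exact mul_le_mul (by linarith) this a4 (by positivity)

namespace Uncertainty

variable {U : Uncertainty n m r} {F : Setup n m r} {ρ : ℝ}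

theorem BoundedBy.coeffs_mem (hU : U.BoundedBy ρ) (σ : U.Param) :
    (U.sys σ).coeffs ∈ coeffSet n m r ρ := by
  obtain ⟨hA, hΓ, hΓ', hR, hQ⟩ := hU σ
  exact (isRegular_sys σ).coeffs_mem hA hΓ hR hQ
    (dotProduct_self_le_of_norm_inv_le (isRegular_sys σ).posDef_Γ hΓ')

/-- The inverse of a mean is not the mean of the inverses, so the bound is passed through the linear
inequality `u ⬝ᵥ u ≤ ρ * sqNorm Q u`. -/
theorem BoundedBy.norm_inv_meanSys_Q_le (hU : U.BoundedBy ρ) : ‖U.meanSys.Q⁻¹‖ ≤ ρ := by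
  have σ₀ : U.Param := Classical.arbitrary _
  refine norm_inv_le_of_dotProduct_self_le isRegular_meanSys.posDef_Q
    ((norm_nonneg _).trans (hU σ₀).1) fun u => ?_
  have e : sqNorm U.meanSys.Q u = mean fun σ => sqNorm (U.sys σ).Q u := sqNorm_mean _ u
  rw [e, ← mean_const_mul, ← mean_const (ι := U.Param) (u ⬝ᵥ u)]
  exact mean_le_mean fun σ =>
    dotProduct_self_le_of_norm_inv_le (isRegular_sys σ).posDef_Q (hU σ).2.2.2.2 u

theorem BoundedBy.coeffs_meanSys_mem (hU : U.BoundedBy ρ) :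
    U.meanSys.coeffs ∈ coeffSet n m r ρ := by
  have key : ∀ {V : Type} [NormedAddCommGroup V] [NormedSpace ℝ V] (f : U.Param → V),
      (∀ σ, ‖f σ‖ ≤ ρ) → ‖mean f‖ ≤ ρ := fun f hf =>
    (norm_mean_le f).trans ((mean_le_mean hf).trans (mean_const ρ).le)
  refine isRegular_meanSys.coeffs_mem (key _ fun σ => (hU σ).1) (key _ fun σ => (hU σ).2.1)
    (key _ fun σ => (hU σ).2.2.2.1) hU.norm_inv_meanSys_Q_le fun u => ?_
  have e : sqNorm U.meanSys.Γ u = mean fun σ => sqNorm (U.sys σ).Γ u := sqNorm_mean _ u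
  rw [e, ← mean_const_mul, ← mean_const (ι := U.Param) (u ⬝ᵥ u)]
  exact mean_le_mean fun σ =>
    dotProduct_self_le_of_norm_inv_le (isRegular_sys σ).posDef_Γ (hU σ).2.2.1 u

theorem norm1_meanSys_sub_le (σ' : U.Param) :
    (U.meanSys - U.sys σ').norm1 ≤ U.deviation σ' := by
  have key : ∀ {V : Type} [NormedAddCommGroup V] [NormedSpace ℝ V] (f : U.Param → V),
      ‖mean f - f σ'‖ ≤ mean fun σ => ‖f σ - f σ'‖ := fun f => by
    rw [mean_sub_const]; exact norm_mean_le _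
  have e : U.deviation σ' = (mean fun σ => ‖(U.sys σ).A - (U.sys σ').A‖)
      + (mean fun σ => ‖(U.sys σ).Γ - (U.sys σ').Γ‖)
      + (mean fun σ => ‖(U.sys σ).R - (U.sys σ').R‖)
      + (mean fun σ => ‖(U.sys σ).Q - (U.sys σ').Q‖) := by
    rw [← mean_add, ← mean_add, ← mean_add]; rfl
  rw [e]
  exact add_le_add (add_le_add (add_le_add (key fun σ => (U.sys σ).A) (key fun σ => (U.sys σ).Γ))
    (key fun σ => (U.sys σ).R)) (key fun σ => (U.sys σ).Q)

theorem deviation_nonneg (σ' : U.Param) : 0 ≤ U.deviation σ' :=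
  mean_nonneg fun σ => by rw [Sys.norm1]; positivity

/-- At each time, the expected energy is a quadratic function with a unique minimizer, which is
characterized by its optimality condition. -/
theorem isEnergyMin_iff_and_optimality {t : ℝ} (ht : t ∈ Icc 0 F.T) :
    (∀ ξ, U.IsEnergyMin F t ξ ↔ ξ = U.estEnergy F t) ∧
      (mean fun σ => flowPrec F (U.sys σ).coeffs t *ᵥ
        (U.estEnergy F t - flowFilter F (U.sys σ).coeffs t)) = 0 := by
  have hP : ∀ σ : U.Param, (flowPrec F (U.sys σ).coeffs t).PosDef := fun σ =>
    (isRegular_sys σ).admissible.flowPrec_posDef ht.1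
  obtain ⟨ξ₀, h0, h1⟩ := exists_minimizer_mean_sqNorm hP
    (fun σ => flowFilter F (U.sys σ).coeffs t)
    (fun σ => 1 / 2 * ∫ s in (0 : ℝ)..t,
      sqNorm (U.sys σ).Q⁻¹ (F.y s - F.C *ᵥ flowFilter F (U.sys σ).coeffs s))
  have hE : ∀ ζ, U.energy F t ζ = U.energy F t ξ₀
      + 1 / 2 * sqNorm (mean fun σ : U.Param => flowPrec F (U.sys σ).coeffs t) (ζ - ξ₀) := by
    intro ζ
    simp only [energy, valueFn_eq (isRegular_sys _) ht]
    exact h1 ζ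
  have hmin : U.IsEnergyMin F t ξ₀ := fun ζ => by
    rw [hE ζ]
    have := sqNorm_nonneg (posDef_mean hP).posSemidef (ζ - ξ₀)
    linarith
  have huniq : ∀ ξ, U.IsEnergyMin F t ξ → ξ = ξ₀ := fun ξ hξ => by
    by_contra hne
    have h2 := hξ ξ₀
    rw [hE ξ] at h2
    have := sqNorm_pos (posDef_mean hP) (sub_ne_zero.2 hne)
    linarith
  have hest : U.estEnergy F t = ξ₀ :=
    huniq _ (Classical.epsilon_spec (p := U.IsEnergyMin F t) ⟨ξ₀, hmin⟩)
  rw [hest]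
  exact ⟨fun ξ => ⟨huniq ξ, fun h => h ▸ hmin⟩, h0⟩

theorem error_le {t : ℝ} (ht : t ∈ Icc 0 F.T) {L : ℝ} (hL : 0 ≤ L) {σ : U.Param}
    (h : ∀ u v : Fin n → ℝ, |u ⬝ᵥ (flowPrec F (U.sys σ).coeffs t *ᵥ v)| ≤ L * (‖u‖ * ‖v‖))
    (xhat : ℝ → Fin n → ℝ) :
    U.error F xhat t σ ≤ √L * ‖xhat t - flowFilter F (U.sys σ).coeffs t‖ := by
  have ha := (isRegular_sys σ).admissible
  rw [error, wNorm, precision_eq ha ht, kalman_eq ha ht]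
  set w := xhat t - flowFilter F (U.sys σ).coeffs t
  calc √(sqNorm (flowPrec F (U.sys σ).coeffs t) w) ≤ √(L * ‖w‖ ^ 2) :=
        Real.sqrt_le_sqrt ((le_abs_self _).trans ((h w w).trans (le_of_eq (by ring))))
    _ = √L * ‖w‖ := by rw [Real.sqrt_mul hL, Real.sqrt_sq (norm_nonneg _)]

end Uncertainty

/-- All three estimators are Lipschitz in the deviation of the systems, uniformly over all
uncertain systems with the same bound. -/
theorem exists_estimator_bounds (F : Setup n m r) (ρ : ℝ) :
    ∃ c₁ c₂ c₃ : ℝ, 0 < c₁ ∧ 0 < c₂ ∧ 0 < c₃ ∧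
      ∀ U : Uncertainty n m r, U.BoundedBy ρ → ∀ t ∈ Icc 0 F.T, ∀ σ',
        U.error F (U.estExpSys F) t σ' ≤ c₁ * U.deviation σ' ∧
        U.error F (U.estMean F) t σ' ≤ c₂ * U.deviation σ' ∧
        U.error F (U.estEnergy F) t σ' ≤ c₃ * U.deviation σ' := by
  obtain ⟨L, hL, hlip⟩ := exists_lipschitz_flowFilter F ρ
  obtain ⟨a, ha, hPa⟩ := exists_bound_flowPrec F ρ
  obtain ⟨b, hb, hPb⟩ := exists_coercive_flowPrec F ρ
  set k := L * (1 + ρ ^ 2) with hk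
  have hk0 : 0 ≤ k := by positivity
  -- The factor `√a` converts the sup norm to the weighted norm, `k` is the Lipschitz constant of
  -- the filter with respect to `norm1`, and `b * a` comes from the minimizer estimate. Adding `1`
  -- only ensures strict positivity.
  refine ⟨√a * k + 1, √a * k + 1, √a * (b * a * k) + 1, by positivity, by positivity,
    by positivity, fun U hU t ht σ' => ?_⟩
  have hdev := Uncertainty.deviation_nonneg σ'
  have hd : ∀ σ : U.Param, ‖flowFilter F (U.sys σ).coeffs t - flowFilter F (U.sys σ').coeffs t‖
      ≤ k * (U.sys σ - U.sys σ').norm1 := fun σ => by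
    refine (hlip t ht _ (hU.coeffs_mem σ) _ (hU.coeffs_mem σ')).trans ?_
    rw [hk, mul_assoc]
    exact mul_le_mul_of_nonneg_left ((Uncertainty.isRegular_sys σ).norm_coeffs_sub_le
      (Uncertainty.isRegular_sys σ') (hU σ).2.2.2.2 (hU σ').2.2.2.2) hL
  have hdm : (mean fun σ : U.Param =>
      ‖flowFilter F (U.sys σ).coeffs t - flowFilter F (U.sys σ').coeffs t‖)
        ≤ k * U.deviation σ' := by
    rw [Uncertainty.deviation, ← mean_const_mul]
    exact mean_le_mean hd
  have key : ∀ (xhat : ℝ → Fin n → ℝ) (q : ℝ),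
      ‖xhat t - flowFilter F (U.sys σ').coeffs t‖ ≤ q * U.deviation σ' →
      U.error F xhat t σ' ≤ (√a * q + 1) * U.deviation σ' := fun xhat q hq => by
    refine (Uncertainty.error_le ht ha (hPa t ht _ (hU.coeffs_mem σ')) xhat).trans ?_
    have := mul_le_mul_of_nonneg_left hq (Real.sqrt_nonneg a)
    linarith
  refine ⟨key _ _ ?_, key _ _ ?_, key _ _ ?_⟩
  · rw [Uncertainty.estExpSys, kalman_eq Uncertainty.isRegular_meanSys.admissible ht]
    refine (hlip t ht _ hU.coeffs_meanSys_mem _ (hU.coeffs_mem σ')).trans ?_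
    rw [hk, mul_assoc]
    refine mul_le_mul_of_nonneg_left ((Uncertainty.isRegular_meanSys.norm_coeffs_sub_le
      (Uncertainty.isRegular_sys σ') hU.norm_inv_meanSys_Q_le (hU σ').2.2.2.2).trans ?_) hL
    exact mul_le_mul_of_nonneg_left (Uncertainty.norm1_meanSys_sub_le σ') (by positivity)
  · simp only [Uncertainty.estMean, kalman_eq (Uncertainty.isRegular_sys _).admissible ht]
    rw [mean_sub_const]
    exact (norm_mean_le _).trans hdm
  · refine (norm_minimizer_sub_le (Uncertainty.isEnergyMin_iff_and_optimality ht).2 ha hb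
      (fun σ => hPa t ht _ (hU.coeffs_mem σ)) (fun σ => hPb t ht _ (hU.coeffs_mem σ)) σ').trans ?_
    rw [mul_assoc (b * a)]
    exact mul_le_mul_of_nonneg_left hdm (by positivity)

end UncertainKalman

end

theorem mainTheorem8 {n m r : ℕ} (F : UncertainKalman.Setup n m r) (ρ : ℝ) :
    ∃ c₁ c₂ c₃ : ℝ, 0 < c₁ ∧ 0 < c₂ ∧ 0 < c₃ ∧
      ∀ U : UncertainKalman.Uncertainty n m r, U.BoundedBy ρ →
        -- the filters and the three estimators are well defined
        (∀ σ, UncertainKalman.WellPosed F (U.sys σ)) ∧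
        UncertainKalman.WellPosed F U.meanSys ∧
        (∀ t ∈ Set.Icc 0 F.T, ∀ ξ, U.IsEnergyMin F t ξ ↔ ξ = U.estEnergy F t) ∧
        ∀ t ∈ Set.Icc 0 F.T,
          -- `c₁`, `c₂`, `c₃` are constants in the worst case error estimates
          (∀ σ', U.error F (U.estExpSys F) t σ' ≤ c₁ * U.deviation σ') ∧
          (∀ σ', U.error F (U.estMean F) t σ' ≤ c₂ * U.deviation σ') ∧
          (∀ σ', U.error F (U.estEnergy F) t σ' ≤ c₃ * U.deviation σ') ∧
          -- and in the estimates of the expected errors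
          UncertainKalman.mean (U.error F (U.estExpSys F) t) ≤
            c₁ * UncertainKalman.mean U.deviation ∧
          UncertainKalman.mean (U.error F (U.estMean F) t) ≤
            c₂ * UncertainKalman.mean U.deviation ∧
          UncertainKalman.mean (U.error F (U.estEnergy F) t) ≤
            c₃ * UncertainKalman.mean U.deviation := by
  obtain ⟨c₁, c₂, c₃, h₁, h₂, h₃, h⟩ := UncertainKalman.exists_estimator_bounds F ρ
  refine ⟨c₁, c₂, c₃, h₁, h₂, h₃, fun U hU =>
    ⟨fun σ => UncertainKalman.wellPosed (UncertainKalman.Uncertainty.isRegular_sys σ).admissible,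
      UncertainKalman.wellPosed UncertainKalman.Uncertainty.isRegular_meanSys.admissible,
      fun t ht => (UncertainKalman.Uncertainty.isEnergyMin_iff_and_optimality ht).1,
      fun t ht => ⟨fun σ => (h U hU t ht σ).1, fun σ => (h U hU t ht σ).2.1,
        fun σ => (h U hU t ht σ).2.2, ?_, ?_, ?_⟩⟩⟩
  -- The expected-error bounds are the averages of the worst-case bounds over the true parameter.
  all_goals rw [← UncertainKalman.mean_const_mul]
  exacts [UncertainKalman.mean_le_mean fun σ => (h U hU t ht σ).1,
    UncertainKalman.mean_le_mean fun σ => (h U hU t ht σ).2.1,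
    UncertainKalman.mean_le_mean fun σ => (h U hU t ht σ).2.2]
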